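/- Let $d\ge 2$, let $\lambda>0$ and $s>0$ be real numbers, and let $r=r(d)>0$ be the radius for which the ball of radius $r$ in $\mathbb{R}^d$ has volume $1$. In the mobile geometric graph model, the nodes are initially located at the points of a Poisson point process of intensity $\lambda$ on $\mathbb{R}^d$, and they move by $d$-dimensional Brownian motions of variance $s^2$ that are independent of each other and of the initial locations. A target is located at $x_i\in\mathbb{R}^d$ at time $i$; it is detected at the time step $i\in\{0,1,2,\dots\}$ if at time $i$ some node is at Euclidean distance at most $r$ from $x_i$. The detection time $T_{\mathrm{det}}\in\{0,1,2,\dots\}\cup\{\infty\}$ is the first time step at which the target is detected. Put $\rho_2(t)=t/\log t$ and $\rho_d(t)=t$ for $d\ge 3$. (i) If the target is fixed at the origin, then $\Pr[T_{\mathrm{det}}\ge t]=\exp(-\Theta(\rho_d(t)))$, that is, there are constants $c,C>0$ and $t_0$, depending only on $\lambda$, $s$ and $d$, such that $\exp(-C\rho_d(t))\le \Pr[T_{\mathrm{det}}\ge t]\le \exp(-c\,\rho_d(t))$ for all integers $t\ge t_0$. (ii) The same holds if the target starts at the origin and moves by Brownian motion of variance $\sigma^2$, $\sigma>0$, independently of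 the nodes, with constants depending only on $\lambda$, $s$, $d$ and $\sigma$ (so only on $\lambda$, $s$ and $d$ when $\sigma=s$). (iii) The upper bound holds for every motion of the target that is independent of the nodes (initial locations and motions): there are $c>0$ and $t_0$, depending only on $\lambda$, $s$ and $d$, such that for every such motion $\Pr[T_{\mathrm{det}}\ge t]\le \exp(-c\,\rho_d(t))$ for all integers $t\ge t_0$. -/

import Mathlib

open MeasureTheory ProbabilityTheory
open scoped NNReal ENNReal

namespace MobileGraph

noncomputable section

/-- `d`-dimensional Euclidean space. -/
abbrev Space (d : ℕ) : Type := EuclideanSpace ℝ (Fin d)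

/-- The number of nodes in the set `A` (possibly infinite), when the node with label `k` is
located at `V k ω`. -/
def nodeCount {Ω : Type*} {d : ℕ} (V : ℕ → Ω → Space d) (A : Set (Space d)) (ω : Ω) : ℕ∞ :=
  {k : ℕ | V k ω ∈ A}.encard

/-- The random points `V 0, V 1, V 2, …` form a (homogeneous) Poisson point process of intensity
`lam` on `ℝ^d`: the number of points in a bounded Borel set `A` has the Poisson law of mean
`lam * |A|`, and the numbers of points in finitely many pairwise disjoint bounded Borel sets are
independent.  For `lam > 0` such a process almost surely has infinitely many points, finitely many
in every bounded set, so that its points can be labelled by the natural numbers. -/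
structure IsPoissonPointProcess {Ω : Type*} [MeasurableSpace Ω] {d : ℕ} (lam : ℝ≥0)
    (V : ℕ → Ω → Space d) (P : Measure Ω) : Prop where
  measurable : ∀ k, Measurable (V k)
  poisson : ∀ A : Set (Space d), MeasurableSet A → Bornology.IsBounded A → ∀ n : ℕ,
    P {ω | nodeCount V A ω = n} = poissonMeasure (lam * (volume A).toNNReal) {n}
  indep : ∀ (m : ℕ) (A : Fin m → Set (Space d)), (∀ j, MeasurableSet (A j)) →
    (∀ j, Bornology.IsBounded (A j)) → (∀ i j, i ≠ j → Disjoint (A i) (A j)) →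
    iIndepFun (fun j ω => nodeCount V (A j) ω) P

/-- `W` is a `d`-dimensional Brownian motion of variance `s ^ 2` started at the origin: its
coordinates are `s` times independent standard real Brownian motions (with almost surely
continuous paths). -/
structure IsBrownianMotion {Ω : Type*} [MeasurableSpace Ω] {d : ℕ} (s : ℝ)
    (W : ℝ≥0 → Ω → Space d) (P : Measure Ω) : Prop where
  measurable : ∀ t, Measurable (W t)
  exists_coord : ∃ B : Fin d → ℝ≥0 → Ω → ℝ,
    (∀ j, IsBrownianReal (B j) P) ∧
    iIndepFun (fun (j : Fin d) (ω : Ω) (t : ℝ≥0) => B j t ω) P ∧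
    ∀ t ω j, W t ω j = s * B j t ω

/-- The moving nodes of a mobile geometric graph of intensity `lam` and range of motion `s`.
The nodes are labelled by `ℕ`; `V k` is the initial location of the node `k`, and `W k` is its
displacement, so that it is at `V k ω + W k t ω` at time `t`.  The initial locations form a Poisson
point process, the displacements are independent Brownian motions of variance `s ^ 2`, and they
are independent of the initial locations. -/
structure IsMobileGeometricGraph {Ω : Type*} [MeasurableSpace Ω] {d : ℕ} (lam : ℝ≥0) (s : ℝ)
    (V : ℕ → Ω → Space d) (W : ℕ → ℝ≥0 → Ω → Space d) (P : Measure Ω) : Prop where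
  poisson : IsPoissonPointProcess lam V P
  brownian : ∀ k, IsBrownianMotion s (W k) P
  indep_motions : iIndepFun (fun (k : ℕ) (ω : Ω) (t : ℝ≥0) => W k t ω) P
  indep_initial : IndepFun (fun (ω : Ω) (k : ℕ) => V k ω)
    (fun (ω : Ω) (k : ℕ) (t : ℝ≥0) => W k t ω) P

/-- The motion `X` of the target (as a whole process) is independent of the nodes, that is, of the
family of all initial locations and all displacements. -/
def IsIndependentOfNodes {Ω : Type*} [MeasurableSpace Ω] {d : ℕ} (X : ℝ≥0 → Ω → Space d)
    (V : ℕ → Ω → Space d) (W : ℕ → ℝ≥0 → Ω → Space d) (P : Measure Ω) : Prop :=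
  IndepFun (fun (ω : Ω) (t : ℝ≥0) => X t ω)
    (fun ω : Ω => ((fun k : ℕ => V k ω), (fun (k : ℕ) (t : ℝ≥0) => W k t ω))) P

/-- At the time step `i` the target is detected: some node is within distance `r` of it. -/
def Detected {Ω : Type*} {d : ℕ} (r : ℝ) (V : ℕ → Ω → Space d) (W : ℕ → ℝ≥0 → Ω → Space d)
    (X : ℝ≥0 → Ω → Space d) (i : ℕ) (ω : Ω) : Prop :=
  ∃ k : ℕ, dist (V k ω + W k i ω) (X i ω) ≤ r

/-- The detection time: the first time step `i ∈ {0, 1, 2, …}` at which the target is detected,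
and `∞` if it is never detected. -/
def detectionTime {Ω : Type*} {d : ℕ} (r : ℝ) (V : ℕ → Ω → Space d)
    (W : ℕ → ℝ≥0 → Ω → Space d) (X : ℝ≥0 → Ω → Space d) (ω : Ω) : ℕ∞ :=
  ⨅ (i : ℕ) (_ : Detected r V W X i ω), (i : ℕ∞)

/-- The order of the exponent: `t / log t` in dimension `2`, and `t` in higher dimensions. -/
def tailRate (d t : ℕ) : ℝ := if d = 2 then (t : ℝ) / Real.log t else (t : ℝ)

end

end MobileGraph

/-! Fix the path `x` of the target. The nodes, marked by their displacements, form a marked Poisson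
process, so the number of nodes that meet the target before time `t` is Poisson. The tail is
therefore `exp (-lam * Φ(x))`, where `Φ(x)`, the `sweptVolume`, is the integral over `y` of the
probability that a node started at `y` hits `x`. A random independent target averages this formula
over `x` (`measure_le_detectionTime`).

Upper bound of the tail: `Φ(x)` is bounded below uniformly in `x` by the second moment method under
Lebesgue measure times `P`. The number of visits has mean `t`. Its second moment is at most `2 * t`
times the sum over `k < t` of bounds for the probability of a return after `k` steps. The centred
Gaussian density is largest at the origin, so these bounds, of order `k ^ (-d / 2)`, do not depend
on `x`. Their sum is of order `log t` in the plane and bounded for `d ≥ 3`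
(`exists_le_lintegral_measure_hits`).

Lower bound of the tail: by Jensen it suffices to bound the mean of `Φ` from above. Subtracting the
target's path leaves one Gaussian walk and a fixed ball. For `d ≥ 3` the union bound over times is
enough. In the plane, a walk that has reached the ball then spends a mean time of order `log t` in
the doubled ball, while the total mean time there, integrated over `y`, is of order `t`; hence the
bound `t / log t` (`exists_lintegral_measure_hits_le`). -/

namespace MobileGraph

open Filter Topology

/-! ### Laplace functional of a Poisson point process -/

section Poisson

variable {Ω : Type*} {d : ℕ} {V : ℕ → Ω → Space d}

/-- The number of labels below `K` whose node is in `A` is eventually the number of nodes in `A`. -/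
lemma eventually_card_filter_eq_nodeCount (A : Set (Space d)) [DecidablePred (· ∈ A)] {ω : Ω}
    (h : nodeCount V A ω ≠ ⊤) :
    ∀ᶠ K in atTop, ((Finset.range K).filter (fun k => V k ω ∈ A)).card =
      (nodeCount V A ω).toNat := by
  have hfin : {k | V k ω ∈ A}.Finite := Set.encard_ne_top_iff.1 h
  obtain ⟨M, hM⟩ := hfin.bddAbove
  filter_upwards [eventually_gt_atTop M] with K hK
  have hs : {k | V k ω ∈ A} = ((Finset.range K).filter (fun k => V k ω ∈ A) : Finset ℕ) := by
    ext k
    simp only [Set.mem_ofPred_eq, Finset.coe_filter, Finset.mem_range]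
    exact ⟨fun hk => ⟨(hM hk).trans_lt hK, hk⟩, fun hk => hk.2⟩
  rw [nodeCount, hs, Set.encard_coe_eq_coe_finsetCard]
  simp

lemma antitone_prod_range {u : ℕ → ℝ≥0∞} (hu : ∀ k, u k ≤ 1) :
    Antitone fun K => ∏ k ∈ Finset.range K, u k := by
  refine antitone_nat_of_succ_le fun K => ?_
  rw [Finset.prod_range_succ]
  exact mul_le_of_le_one_right' (hu K)

variable [MeasurableSpace Ω] {P : Measure Ω} {lam : ℝ≥0}

/-- The probability generating function of the Poisson law. -/
lemma lintegral_pow_poissonMeasure (m : ℝ≥0) {z : ℝ} (hz : 0 ≤ z) :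
    ∫⁻ n, ENNReal.ofReal z ^ n ∂(poissonMeasure m) = ENNReal.ofReal (Real.exp (-(m * (1 - z)))) := by
  rw [lintegral_countable']
  have h : HasSum (fun n : ℕ => Real.exp (-m) * (m * z) ^ n / n.factorial)
      (Real.exp (-(m * (1 - z)))) := by
    have := (NormedSpace.expSeries_div_hasSum_exp ((m : ℝ) * z)).mul_left (Real.exp (-m))
    rw [← Real.exp_eq_exp_ℝ, ← Real.exp_add] at this
    convert! this using 1
    · simp_rw [mul_div_assoc]
    · ring_nf
  rw [← h.tsum_eq, ENNReal.ofReal_tsum_of_nonneg (fun n => by positivity) h.summable]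
  refine tsum_congr fun n => ?_
  rw [poissonMeasure_singleton, ← ENNReal.ofReal_pow hz, ← ENNReal.ofReal_mul (by positivity)]
  congr 1
  rw [mul_pow]
  ring

lemma measurable_nodeCount (hV : ∀ k, Measurable (V k)) {A : Set (Space d)}
    (hA : MeasurableSet A) : Measurable (nodeCount V A) := by
  have key : ∀ ω, ((nodeCount V A ω : ℕ∞) : ℝ≥0∞) = ∑' k, A.indicator (fun _ => 1) (V k ω) := by
    intro ω
    rw [nodeCount, ← ENNReal.tsum_set_one, tsum_subtype _ (fun _ => (1 : ℝ≥0∞))]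
    rfl
  have hm : Measurable fun ω => ∑' k, A.indicator (fun _ => (1 : ℝ≥0∞)) (V k ω) :=
    Measurable.tsum fun k => (measurable_const.indicator hA).comp (hV k)
  refine measurable_to_countable' fun x => ?_
  have : nodeCount V A ⁻¹' {x} =
      (fun ω => ∑' k, A.indicator (fun _ => (1 : ℝ≥0∞)) (V k ω)) ⁻¹' {(x : ℝ≥0∞)} := by
    ext ω
    simp [← key]
  rw [this]
  exact hm (measurableSet_singleton _)

/-- The finite values of the count carry the Poisson masses, which already add up to one. -/
lemma IsPoissonPointProcess.nodeCount_ne_top [IsProbabilityMeasure P]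
    (h : IsPoissonPointProcess lam V P) {A : Set (Space d)} (hA : MeasurableSet A)
    (hb : Bornology.IsBounded A) : ∀ᵐ ω ∂P, nodeCount V A ω ≠ ⊤ := by
  have hm := measurable_nodeCount h.measurable hA
  have hset : {ω | nodeCount V A ω ≠ ⊤} = ⋃ n : ℕ, {ω | nodeCount V A ω = n} := by
    ext ω
    simp only [Set.mem_ofPred_eq, Set.mem_iUnion, ENat.ne_top_iff_exists]
    exact exists_congr fun n => eq_comm
  have hmeas : ∀ x : ℕ∞, MeasurableSet {ω | nodeCount V A ω = x} := fun x =>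
    hm (MeasurableSet.of_discrete (s := {x}))
  have hU : P (⋃ n : ℕ, {ω | nodeCount V A ω = n}) = ∑' n : ℕ, P {ω | nodeCount V A ω = n} := by
    refine measure_iUnion (fun i j hij => ?_) fun n => hmeas n
    rw [Function.onFun, Set.disjoint_left]
    intro ω hi hj
    simp only [Set.mem_ofPred_eq] at hi hj
    exact hij (by exact_mod_cast hi.symm.trans hj)
  rw [ae_iff_prob_eq_one (p := fun ω => nodeCount V A ω ≠ ⊤)
    (measurableSet_setOfPred.1 (hset ▸ MeasurableSet.iUnion fun n => hmeas n)), hset, hU]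
  simp_rw [h.poisson A hA hb]
  rw [← measure_univ (μ := poissonMeasure (lam * (volume A).toNNReal)),
    ← Set.iUnion_of_singleton, measure_iUnion _ fun n => measurableSet_singleton n]
  intro i j hij
  simpa using hij

lemma IsPoissonPointProcess.hasLaw_toNat_nodeCount [IsProbabilityMeasure P]
    (h : IsPoissonPointProcess lam V P) {A : Set (Space d)} (hA : MeasurableSet A)
    (hb : Bornology.IsBounded A) :
    HasLaw (fun ω => (nodeCount V A ω).toNat) (poissonMeasure (lam * (volume A).toNNReal)) P where
  aemeasurable := (Measurable.of_discrete.comp (measurable_nodeCount h.measurable hA)).aemeasurable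
  map_eq := by
    have hm : Measurable fun ω => (nodeCount V A ω).toNat :=
      Measurable.of_discrete.comp (measurable_nodeCount h.measurable hA)
    refine Measure.ext_of_singleton fun n => ?_
    rw [Measure.map_apply hm (measurableSet_singleton _), ← h.poisson A hA hb]
    refine measure_congr ?_
    filter_upwards [h.nodeCount_ne_top hA hb] with ω hω
    refine propext ?_
    change (nodeCount V A ω).toNat = n ↔ nodeCount V A ω = n
    lift nodeCount V A ω to ℕ using hω with N
    simp

lemma IsPoissonPointProcess.lintegral_pow_nodeCount [IsProbabilityMeasure P]
    (h : IsPoissonPointProcess lam V P) {A : Set (Space d)} (hA : MeasurableSet A)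
    (hb : Bornology.IsBounded A) {c : ℝ≥0∞} (hc : c ≤ 1) :
    ∫⁻ ω, (1 - c) ^ (nodeCount V A ω).toNat ∂P =
      ENNReal.ofReal (Real.exp (-(lam * (c * volume A).toReal))) := by
  have hc' : 1 - c = ENNReal.ofReal (1 - c.toReal) := by
    rw [ENNReal.ofReal_sub _ ENNReal.toReal_nonneg, ENNReal.ofReal_one,
      ENNReal.ofReal_toReal (ne_top_of_le_ne_top ENNReal.one_ne_top hc)]
  have hc1 : c.toReal ≤ 1 := ENNReal.toReal_le_of_le_ofReal zero_le_one (by simpa using hc)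
  rw [(h.hasLaw_toNat_nodeCount hA hb).lintegral_comp (f := fun n => (1 - c) ^ n) (by fun_prop),
    hc', lintegral_pow_poissonMeasure _ (by linarith), ENNReal.toReal_mul]
  push_cast
  congr 3
  ring

/-- The Laplace functional of a Poisson point process, for a simple function. -/
lemma IsPoissonPointProcess.lintegral_iInf_prod_simpleFunc [IsProbabilityMeasure P]
    (h : IsPoissonPointProcess lam V P) (φ : SimpleFunc (Space d) ℝ≥0∞) (hφ : ∀ y, φ y ≤ 1)
    (hb : Bornology.IsBounded (Function.support φ)) :
    ∫⁻ ω, ⨅ K, ∏ k ∈ Finset.range K, (1 - φ (V k ω)) ∂P =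
      ENNReal.ofReal (Real.exp (-(lam * (∫⁻ y, φ y).toReal))) := by
  classical
  -- The value `0` is dropped because its fibre is unbounded; it contributes a factor `1` to the
  -- product and nothing to the integral.
  set s : Finset ℝ≥0∞ := φ.range.erase 0 with hs
  have hsA : ∀ c ∈ s, MeasurableSet (φ ⁻¹' {c}) ∧ Bornology.IsBounded (φ ⁻¹' {c}) ∧ c ≤ 1 := by
    intro c hc
    obtain ⟨hc0, hc⟩ := Finset.mem_erase.1 hc
    refine ⟨φ.measurableSet_fiber c, hb.subset fun y hy => ?_, ?_⟩
    · rw [Function.mem_support, show φ y = c from hy]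
      exact hc0
    · obtain ⟨y, rfl⟩ := SimpleFunc.mem_range.1 hc
      exact hφ y
  have hprod : ∀ᵐ ω ∂P, ⨅ K, ∏ k ∈ Finset.range K, (1 - φ (V k ω)) =
      ∏ c ∈ s, (1 - c) ^ (nodeCount V (φ ⁻¹' {c}) ω).toNat := by
    have hne : ∀ᵐ ω ∂P, ∀ c ∈ s, nodeCount V (φ ⁻¹' {c}) ω ≠ ⊤ :=
      (ae_ball_iff s.countable_toSet).2 fun c hc =>
        h.nodeCount_ne_top (hsA c hc).1 (hsA c hc).2.1
    filter_upwards [hne] with ω hω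
    -- Both sides are limits of the partial products: these decrease to their infimum, and they are
    -- constant once every label of a node in the support has been counted.
    refine tendsto_nhds_unique
      (tendsto_atTop_iInf (antitone_prod_range fun k => tsub_le_self)) ?_
    refine tendsto_const_nhds.congr' ?_
    have : ∀ᶠ K in atTop, ∀ c ∈ s, ((Finset.range K).filter (fun k => V k ω ∈ φ ⁻¹' {c})).card =
        (nodeCount V (φ ⁻¹' {c}) ω).toNat :=
      (Filter.eventually_all_finset s).2 fun c hc =>
        eventually_card_filter_eq_nodeCount _ (hω c hc)
    filter_upwards [this] with K hK
    rw [← Finset.prod_fiberwise_of_maps_to (t := φ.range) (g := fun k => φ (V k ω))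
      fun k _ => φ.mem_range_self _, hs]
    rw [← Finset.prod_erase φ.range (a := 0)]
    · refine Finset.prod_congr rfl fun c hc => ?_
      rw [Finset.prod_congr rfl (g := fun _ => 1 - c), Finset.prod_const, ← hK c hc]
      · simp only [Set.mem_preimage, Set.mem_singleton_iff]
      · intro k hk
        rw [(Finset.mem_filter.1 hk).2]
    · refine Finset.prod_eq_one fun k hk => ?_
      rw [(Finset.mem_filter.1 hk).2, tsub_zero]
  rw [lintegral_congr_ae hprod]
  have hind : iIndepFun (fun (c : s) ω => nodeCount V (φ ⁻¹' {c.1}) ω) P := by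
    have := h.indep s.card (fun j => φ ⁻¹' {(s.equivFin.symm j).1})
      (fun j => (hsA _ (s.equivFin.symm j).2).1) (fun j => (hsA _ (s.equivFin.symm j).2).2.1)
      (fun i j hij => by
        refine Disjoint.preimage _ (Set.disjoint_singleton.2 fun he => hij ?_)
        exact s.equivFin.symm.injective (Subtype.ext he))
    simpa using this.precomp s.equivFin.injective
  have hind' := hind.comp (fun (c : s) (N : ℕ∞) => (1 - c.1) ^ N.toNat)
    fun c => Measurable.of_discrete
  have hmul := lintegral_prod_eq_prod_lintegral_of_indepFun Finset.univ _ hind' fun c =>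
    Measurable.of_discrete.comp (measurable_nodeCount h.measurable (hsA c.1 c.2).1)
  simp only [Function.comp_apply] at hmul
  have hcoe : ∀ ω, ∏ c ∈ s, (1 - c) ^ (nodeCount V (φ ⁻¹' {c}) ω).toNat =
      ∏ c : s, (1 - c.1) ^ (nodeCount V (φ ⁻¹' {c.1}) ω).toNat := fun ω =>
    (Finset.prod_coe_sort s fun c => (1 - c) ^ (nodeCount V (φ ⁻¹' {c}) ω).toNat).symm
  simp_rw [hcoe]
  rw [hmul, Finset.prod_congr rfl fun c _ =>
    h.lintegral_pow_nodeCount (hsA c.1 c.2).1 (hsA c.1 c.2).2.1 (hsA c.1 c.2).2.2,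
    ← ENNReal.ofReal_prod_of_nonneg fun _ _ => (Real.exp_pos _).le, ← Real.exp_sum,
    Finset.sum_neg_distrib, ← Finset.mul_sum, φ.lintegral_eq_lintegral, SimpleFunc.lintegral,
    ← Finset.sum_erase φ.range (a := 0) (by simp), ENNReal.toReal_sum,
    Finset.sum_coe_sort s fun c => (c * volume (φ ⁻¹' {c})).toReal]
  intro c hc
  exact ENNReal.mul_ne_top (ne_top_of_le_ne_top ENNReal.one_ne_top (hsA c hc).2.2)
    (hsA c hc).2.1.measure_lt_top.ne

/-- The Laplace functional of a Poisson point process. -/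
lemma IsPoissonPointProcess.lintegral_iInf_prod [IsProbabilityMeasure P]
    (h : IsPoissonPointProcess lam V P) {f : Space d → ℝ≥0∞} (hf : Measurable f)
    (hf1 : ∀ y, f y ≤ 1) (hint : ∫⁻ y, f y ≠ ∞) :
    ∫⁻ ω, ⨅ K, ∏ k ∈ Finset.range K, (1 - f (V k ω)) ∂P =
      ENNReal.ofReal (Real.exp (-(lam * (∫⁻ y, f y).toReal))) := by
  -- Simple functions increasing to `f`, cut off to balls so that the supports are bounded.
  set φ : ℕ → SimpleFunc (Space d) ℝ≥0∞ := fun n =>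
    (SimpleFunc.eapprox f n).restrict (Metric.closedBall 0 n) with hφ
  have hφ_apply : ∀ n y, φ n y =
      (Metric.closedBall 0 (n : ℝ)).indicator (SimpleFunc.eapprox f n) y := fun n y => by
    rw [hφ, SimpleFunc.restrict_apply _ Metric.isClosed_closedBall.measurableSet]
  have hle : ∀ n y, φ n y ≤ f y := fun n y => by
    rw [hφ_apply]
    exact (Set.indicator_le_self' (fun _ _ => zero_le) y).trans
      ((le_iSup (fun n => SimpleFunc.eapprox f n y) n).trans_eq
        (SimpleFunc.iSup_eapprox_apply hf y))
  have hmono : Monotone fun n y => φ n y := by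
    intro m n hmn y
    simp only [hφ_apply]
    refine (Set.indicator_le_indicator_of_subset (Metric.closedBall_subset_closedBall ?_)
      (fun _ => zero_le) y).trans (Set.indicator_le_indicator (SimpleFunc.monotone_eapprox f hmn y))
    exact_mod_cast hmn
  have hsup : ∀ y, ⨆ n, φ n y = f y := by
    intro y
    refine le_antisymm (iSup_le fun n => hle n y) ?_
    rw [← SimpleFunc.iSup_eapprox_apply hf y]
    refine iSup_le fun n => ?_
    obtain ⟨m, hm⟩ := exists_nat_ge ‖y‖
    refine le_iSup_of_le (max n m) ?_
    rw [hφ_apply, Set.indicator_of_mem]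
    · exact SimpleFunc.monotone_eapprox f (le_max_left n m) y
    · rw [mem_closedBall_zero_iff]
      exact hm.trans (by exact_mod_cast le_max_right n m)
  have hstep : ∀ n, ∫⁻ ω, ⨅ K, ∏ k ∈ Finset.range K, (1 - φ n (V k ω)) ∂P =
      ENNReal.ofReal (Real.exp (-(lam * (∫⁻ y, φ n y).toReal))) := fun n =>
    h.lintegral_iInf_prod_simpleFunc (φ n) (fun y => (hle n y).trans (hf1 y))
      (Metric.isBounded_closedBall.subset fun y hy => by
        by_contra hyn
        exact hy (by rw [hφ_apply, Set.indicator_of_notMem hyn]))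
  have hlim : Tendsto (fun n => ∫⁻ y, φ n y) atTop (𝓝 (∫⁻ y, f y)) := by
    have := tendsto_atTop_iSup (f := fun n => ∫⁻ y, φ n y) fun m n hmn => lintegral_mono (hmono hmn)
    rw [← lintegral_iSup (fun n => (φ n).measurable) hmono] at this
    simpa only [hsup] using this
  have hR : Tendsto (fun n => ENNReal.ofReal (Real.exp (-(lam * (∫⁻ y, φ n y).toReal)))) atTop
      (𝓝 (ENNReal.ofReal (Real.exp (-(lam * (∫⁻ y, f y).toReal))))) := by
    refine ENNReal.tendsto_ofReal ((Real.continuous_exp.tendsto _).comp ?_)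
    exact (((ENNReal.tendsto_toReal hint).comp hlim).const_mul _).neg
  refine tendsto_nhds_unique ?_ hR
  simp_rw [← hstep]
  have hmeas : ∀ n, Measurable fun ω => ⨅ K, ∏ k ∈ Finset.range K, (1 - φ n (V k ω)) := fun n =>
    Measurable.iInf fun K => Finset.measurable_fun_prod _ fun k _ =>
      measurable_const.sub ((φ n).measurable.comp (h.measurable k))
  -- The two infima commute, and for fixed `K` the finite product is continuous in its factors.
  have hpt : ∀ ω, ⨅ n, ⨅ K, ∏ k ∈ Finset.range K, (1 - φ n (V k ω)) =
      ⨅ K, ∏ k ∈ Finset.range K, (1 - f (V k ω)) := by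
    intro ω
    rw [iInf_comm]
    refine iInf_congr fun K => ?_
    refine tendsto_nhds_unique (tendsto_atTop_iInf fun m n hmn =>
      Finset.prod_le_prod' fun k _ => tsub_le_tsub_left (hmono hmn (V k ω)) 1) ?_
    refine ENNReal.tendsto_finsetProd_of_ne_top _ (fun k _ => ?_) fun k _ =>
      ne_top_of_le_ne_top ENNReal.one_ne_top tsub_le_self
    refine ENNReal.Tendsto.sub tendsto_const_nhds ?_ (Or.inl ENNReal.one_ne_top)
    rw [← hsup]
    exact tendsto_atTop_iSup fun m n hmn => hmono hmn (V k ω)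
  have hanti : Antitone fun n ω => ⨅ K, ∏ k ∈ Finset.range K, (1 - φ n (V k ω)) :=
    fun m n hmn ω => iInf_mono fun K => Finset.prod_le_prod' fun k _ =>
      tsub_le_tsub_left (hmono hmn (V k ω)) 1
  simp_rw [← hpt]
  rw [lintegral_iInf hmeas hanti]
  · exact tendsto_atTop_iInf fun m n hmn => lintegral_mono (hanti hmn)
  · refine ne_top_of_le_ne_top ENNReal.one_ne_top ?_
    calc ∫⁻ ω, ⨅ K, ∏ k ∈ Finset.range K, (1 - φ 0 (V k ω)) ∂P ≤ ∫⁻ _, 1 ∂P :=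
          lintegral_mono fun ω => (iInf_le _ 0).trans (by simp)
      _ = 1 := by simp

end Poisson

end MobileGraph

namespace MobileGraph

open Filter Topology

/-! ### Gaussian laws, Gaussian walks and their independence properties -/

noncomputable section GaussianWalk

/-- The centred Gaussian law on `ℝ^d` whose coordinates are independent of variance `v`. -/
def isoGaussian (d : ℕ) (v : ℝ≥0) : Measure (Space d) :=
  (Measure.pi fun _ : Fin d => gaussianReal 0 v).map (WithLp.toLp 2)

instance (d : ℕ) (v : ℝ≥0) : IsProbabilityMeasure (isoGaussian d v) :=
  Measure.isProbabilityMeasure_map (by fun_prop)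

/-- Characteristic functions determine finite measures, so stability under convolution, symmetry and
the degenerate case all follow from this formula. -/
lemma charFun_isoGaussian (d : ℕ) (v : ℝ≥0) (t : Space d) :
    charFun (isoGaussian d v) t = Complex.exp (-(v * ‖t‖ ^ 2 / 2)) := by
  simp_rw [isoGaussian, charFun_pi, charFun_gaussianReal, ← Complex.exp_sum, ← Complex.ofReal_pow,
    EuclideanSpace.real_norm_sq_eq]
  simp [Finset.mul_sum, Finset.sum_div]

lemma isoGaussian_conv (d : ℕ) (a b : ℝ≥0) :
    (isoGaussian d a).conv (isoGaussian d b) = isoGaussian d (a + b) := by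
  refine Measure.ext_of_charFun (funext fun t => ?_)
  rw [charFun_conv, charFun_isoGaussian, charFun_isoGaussian, charFun_isoGaussian, ← Complex.exp_add]
  congr 1
  push_cast
  ring

lemma isoGaussian_map_neg (d : ℕ) (a : ℝ≥0) :
    (isoGaussian d a).map (fun x => -x) = isoGaussian d a := by
  have : (isoGaussian d a).map (fun x => -x) = (isoGaussian d a).map (fun x => (-1 : ℝ) • x) := by
    simp
  rw [this]
  have := Measure.isProbabilityMeasure_map (μ := isoGaussian d a) (f := fun x => (-1 : ℝ) • x)
    (by fun_prop)
  refine Measure.ext_of_charFun (funext fun t => ?_)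
  rw [charFun_map_smul, charFun_isoGaussian, charFun_isoGaussian]
  simp

lemma isoGaussian_zero (d : ℕ) : isoGaussian d 0 = Measure.dirac 0 := by
  refine Measure.ext_of_charFun (funext fun t => ?_)
  rw [charFun_isoGaussian, charFun_dirac]
  simp

/-- If the random variables of a double family are independent, so are the rows of its transpose. -/
lemma iIndepFun_curry_swap {Ω ι κ E : Type*} [MeasurableSpace Ω] [MeasurableSpace E]
    {P : Measure Ω} {X : ι → κ → Ω → E} (hX : ∀ i j, Measurable (X i j))
    (h : iIndepFun (fun (p : ι × κ) => X p.1 p.2) P) :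
    iIndepFun (fun j ω i => X i j ω) P := by
  have := h.isProbabilityMeasure
  have hp : ∀ i j, IsProbabilityMeasure (P.map (X i j)) := fun i j =>
    Measure.isProbabilityMeasure_map (hX i j).aemeasurable
  have hswap : iIndepFun (fun (p : κ × ι) => X p.2 p.1) P :=
    h.precomp (g := Prod.swap) Prod.swap_injective
  have hrow : ∀ j, iIndepFun (fun i => X i j) P := fun j =>
    h.precomp (g := fun i => (i, j)) fun a b hab => (Prod.ext_iff.1 hab).1
  -- Independence is an identity of joint laws, and a product over pairs is an iterated product by
  -- currying.
  rw [iIndepFun_iff_map_fun_eq_infinitePi_map fun j => measurable_pi_lambda _ fun i => hX i j]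
  have h1 := (iIndepFun_iff_map_fun_eq_infinitePi_map fun p : κ × ι => hX p.2 p.1).1 hswap
  have h2 := fun j => (iIndepFun_iff_map_fun_eq_infinitePi_map fun i => hX i j).1 (hrow j)
  simp_rw [h2]
  rw [← Measure.infinitePi_map_curry (fun j i => P.map (X i j)), ← h1]
  exact (Measure.map_map (g := MeasurableEquiv.curry κ ι E) (by fun_prop)
    (measurable_pi_lambda _ fun p : κ × ι => hX p.2 p.1)).symm

/-- Two independent random variables form an independent family. -/
lemma iIndepFun_bool {Ω E : Type*} [MeasurableSpace Ω] [MeasurableSpace E]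
    {P : Measure Ω} [IsProbabilityMeasure P] {f : Bool → Ω → E}
    (h : IndepFun (f true) (f false) P) : iIndepFun f P := by
  classical
  rw [iIndepFun_iff_measure_inter_preimage_eq_mul]
  intro S sets hsets
  -- Padding with the whole space reduces every index set `S` to the full pair.
  set t : Bool → Set E := fun b => if b ∈ S then sets b else Set.univ with ht
  have htm : ∀ b, MeasurableSet (t b) := fun b => by
    by_cases hb : b ∈ S
    · simpa [ht, hb] using hsets b hb
    · simp [ht, hb]
  have hinter : ⋂ i ∈ S, f i ⁻¹' sets i = f true ⁻¹' t true ∩ f false ⁻¹' t false := by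
    ext ω
    simp only [Set.mem_iInter, Set.mem_preimage, Set.mem_inter_iff, ht, Bool.forall_bool]
    split_ifs <;> simp_all [and_comm]
  have hprod : ∏ i ∈ S, P (f i ⁻¹' sets i) = ∏ i, P (f i ⁻¹' t i) := by
    rw [← Finset.prod_subset S.subset_univ]
    · exact Finset.prod_congr rfl fun i hi => by simp [ht, hi]
    · intro i _ hi
      simp [ht, hi]
  rw [hinter, hprod, Fintype.prod_bool]
  exact h.measure_inter_preimage_eq_mul _ _ (htm _) (htm _)

/-- A random walk on `ℝ^d` from the origin, whose steps are Gaussian of variance `v` in every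
coordinate. -/
structure IsGaussianWalk {Ω : Type*} [MeasurableSpace Ω] {d : ℕ} (v : ℝ≥0)
    (S : ℕ → Ω → Space d) (P : Measure Ω) : Prop where
  measurable : ∀ i, Measurable (S i)
  zero : ∀ᵐ ω ∂P, S 0 ω = 0
  indep : iIndepFun (fun i ω => S (i + 1) ω - S i ω) P
  law : ∀ i, HasLaw (fun ω => S (i + 1) ω - S i ω) (isoGaussian d v) P

section Walk

variable {Ω : Type*} [MeasurableSpace Ω] {d : ℕ} {v : ℝ≥0} {S : ℕ → Ω → Space d} {P : Measure Ω}

/-- A Brownian motion at the integer times is a Gaussian walk. -/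
lemma IsBrownianMotion.isGaussianWalk {s : ℝ} (hs : 0 < s) {W : ℝ≥0 → Ω → Space d}
    (h : IsBrownianMotion s W P) :
    IsGaussianWalk (NNReal.mk (s ^ 2) (sq_nonneg s)) (fun (i : ℕ) ω => W i ω) P := by
  obtain ⟨B, hB, hind, hW⟩ := h.exists_coord
  -- Measurability of `B` is recovered from that of `W`, dividing by `s ≠ 0`.
  have hBm : ∀ j t, Measurable (B j t) := by
    intro j t
    have : B j t = fun ω => s⁻¹ * W t ω j := by
      ext ω
      rw [hW]
      field_simp
    rw [this]
    exact Measurable.const_mul ((measurable_pi_apply j).comp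
      ((WithLp.measurable_ofLp 2 _).comp (h.measurable t))) _
  set ξ : Fin d → ℕ → Ω → ℝ := fun j i ω => s * (B j (i + 1 : ℕ) ω - B j i ω) with hξ
  have hξm : ∀ j i, Measurable (ξ j i) := fun j i => ((hBm j _).sub (hBm j _)).const_mul s
  have hstep : ∀ i ω, W (i + 1 : ℕ) ω - W i ω = WithLp.toLp 2 (fun j => ξ j i ω) := by
    intro i ω
    ext j
    simp only [PiLp.sub_apply, hW, hξ]
    ring
  -- Independence across coordinates combines with independent increments in time; transposing the
  -- double family then gives independent vector steps.
  have hξind : iIndepFun (fun (p : Fin d × ℕ) => ξ p.1 p.2) P := by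
    have := hind.isProbabilityMeasure
    refine iIndepFun_uncurry' hξm ?_ fun j => ?_
    · exact hind.comp (fun j (b : ℝ≥0 → ℝ) (i : ℕ) => s * (b (i + 1 : ℕ) - b i)) fun j => by fun_prop
    · exact ((hB j).toIsPreBrownianReal.hasIndepIncrements.nat Nat.mono_cast).comp
        (fun _ x => s * x) fun _ => by fun_prop
  have hξlaw : ∀ j i, HasLaw (ξ j i) (gaussianReal 0 (NNReal.mk (s ^ 2) (sq_nonneg s))) P := by
    intro j i
    have h1 := (hB j).toIsPreBrownianReal.hasLaw_sub (i + 1 : ℕ) i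
    have h2 : nndist ((i + 1 : ℕ) : ℝ≥0).1 (i : ℝ≥0).1 = 1 := by
      ext
      simp
    rw [h2] at h1
    have h3 := gaussianReal_const_mul h1 s
    rw [mul_zero, mul_one] at h3
    exact h3
  have h1 : iIndepFun (fun i ω j => ξ j i ω) P := iIndepFun_curry_swap hξm hξind
  refine ⟨fun i => h.measurable i, ?_, ?_, fun i => ?_⟩
  · filter_upwards [ae_all_iff.2 fun j => (hB j).toIsPreBrownianReal.eval_zero_ae_eq_zero] with ω hω
    ext j
    rw [Nat.cast_zero, hW, hω]
    simp
  · simp_rw [hstep]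
    exact h1.comp (fun _ x => WithLp.toLp 2 x) fun _ => WithLp.measurable_toLp 2 _
  · simp_rw [hstep]
    have h2 : iIndepFun (fun j => ξ j i) P :=
      hξind.precomp (g := fun j => (j, i)) fun a b hab => (Prod.ext_iff.1 hab).1
    have h3 := iIndepFun.hasLaw_pi (fun j => hξlaw j i) h2
    exact (HasLaw.comp ⟨(WithLp.measurable_toLp 2 _).aemeasurable, rfl⟩ h3)

/-- The difference of two independent Gaussian walks. -/
lemma IsGaussianWalk.sub {a b : ℝ≥0} {S T : ℕ → Ω → Space d} (hS : IsGaussianWalk a S P)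
    (hT : IsGaussianWalk b T P) (hST : IndepFun (fun ω i => S i ω) (fun ω i => T i ω) P) :
    IsGaussianWalk (a + b) (fun i ω => S i ω - T i ω) P := by
  have := hS.indep.isProbabilityMeasure
  -- The two walks become the two rows of one double family of independent steps, whose columns are
  -- summed.
  set ξ : Bool → ℕ → Ω → Space d := fun u i ω =>
    cond u (S (i + 1) ω - S i ω) (-(T (i + 1) ω - T i ω)) with hξ
  have hξm : ∀ u i, Measurable (ξ u i) := by
    rintro (_ | _) i
    · exact ((hT.measurable _).sub (hT.measurable _)).neg
    · exact (hS.measurable _).sub (hS.measurable _)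
  have hst : IndepFun (fun ω i => ξ true i ω) (fun ω i => ξ false i ω) P :=
    hST.comp (φ := fun (x : ℕ → Space d) (i : ℕ) => x (i + 1) - x i)
      (ψ := fun (x : ℕ → Space d) (i : ℕ) => -(x (i + 1) - x i)) (by fun_prop) (by fun_prop)
  have hξind : iIndepFun (fun (p : Bool × ℕ) => ξ p.1 p.2) P := by
    refine iIndepFun_uncurry' hξm ?_ ?_
    · exact iIndepFun_bool hst
    · rintro (_ | _)
      · exact hT.indep.comp (fun _ x => -x) fun _ => measurable_neg
      · exact hS.indep
  have hstep : ∀ i ω, (S (i + 1) ω - T (i + 1) ω) - (S i ω - T i ω) = ξ true i ω + ξ false i ω := by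
    intro i ω
    simp only [hξ, cond_true, cond_false]
    abel
  refine ⟨fun i => (hS.measurable i).sub (hT.measurable i), ?_, ?_, fun i => ?_⟩
  · filter_upwards [hS.zero, hT.zero] with ω h1 h2
    rw [h1, h2, sub_zero]
  · simp_rw [hstep]
    exact (iIndepFun_curry_swap hξm hξind).comp (fun _ x => x true + x false) fun _ => by fun_prop
  · simp_rw [hstep]
    rw [← isoGaussian_conv]
    have hneg := HasLaw.comp ⟨measurable_neg.aemeasurable, isoGaussian_map_neg d b⟩ (hT.law i)
    exact IndepFun.hasLaw_fun_add (hS.law i) hneg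
      (hξind.indepFun (i := (true, i)) (j := (false, i)) (by simp))

lemma IsGaussianWalk.ae_eq_sum (hS : IsGaussianWalk v S P) :
    ∀ᵐ ω ∂P, ∀ i, S i ω = ∑ m ∈ Finset.range i, (S (m + 1) ω - S m ω) := by
  filter_upwards [hS.zero] with ω hω i
  rw [Finset.sum_range_sub fun m => S m ω, hω, sub_zero]

/-- The law of a Gaussian walk. -/
lemma IsGaussianWalk.map_eq (hS : IsGaussianWalk v S P) :
    P.map (fun ω i => S i ω) = (Measure.infinitePi fun _ : ℕ => isoGaussian d v).map
      fun x i => ∑ m ∈ Finset.range i, x m := by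
  have hm : ∀ i, Measurable fun ω => S (i + 1) ω - S i ω :=
    fun i => (hS.measurable _).sub (hS.measurable _)
  rw [← (hS.indep.hasLaw_infinitePi hS.law (measurable_pi_lambda _ hm).aemeasurable).map_eq,
    Measure.map_map (by fun_prop) (measurable_pi_lambda _ hm)]
  refine Measure.map_congr ?_
  filter_upwards [hS.ae_eq_sum] with ω hω
  ext1 i
  exact hω i

/-- An increment of a Gaussian walk is independent of the past. -/
lemma IsGaussianWalk.indepFun_past (hS : IsGaussianWalk v S P) (i k : ℕ) :
    IndepFun (fun ω (j : Fin (i + 1)) => S j ω) (fun ω => S (i + k) ω - S i ω) P := by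
  have hm : ∀ i, Measurable fun ω => S (i + 1) ω - S i ω :=
    fun i => (hS.measurable _).sub (hS.measurable _)
  have hdisj : Disjoint (Finset.range i) (Finset.Ico i (i + k)) := by
    rw [Finset.range_eq_Ico]
    exact Finset.Ico_disjoint_Ico_consecutive 0 i (i + k)
  have h := hS.indep.indepFun_finset (Finset.range i) (Finset.Ico i (i + k)) hdisj hm
  -- The first `i` steps determine the positions up to time `i`, and the next `k` steps determine
  -- the increment.
  have h' := h.comp
    (φ := fun x (j : Fin (i + 1)) => ∑ m : Finset.range i, if m.1 < j then x m else 0)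
    (ψ := fun x => ∑ m, x m) (measurable_pi_lambda _ fun j => Finset.measurable_sum _ fun m _ => by
      split_ifs <;> fun_prop) (by fun_prop)
  refine h'.congr ?_ ?_
  · filter_upwards [hS.ae_eq_sum] with ω hω
    ext1 j
    rw [hω j]
    simp only [Function.comp_apply]
    rw [Finset.sum_coe_sort (Finset.range i)
      (fun m => if m < j then S (m + 1) ω - S m ω else 0), ← Finset.sum_filter]
    refine Finset.sum_congr ?_ fun _ _ => rfl
    ext m
    have := j.2
    simp only [Finset.mem_filter, Finset.mem_range]
    omega
  · filter_upwards with ω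
    simp only [Function.comp_apply]
    rw [Finset.sum_coe_sort (Finset.Ico i (i + k)) (fun m => S (m + 1) ω - S m ω),
      Finset.sum_Ico_sub (fun m => S m ω) (by omega)]

lemma IsGaussianWalk.hasLaw_sub (hS : IsGaussianWalk v S P) (i k : ℕ) :
    HasLaw (fun ω => S (i + k) ω - S i ω) (isoGaussian d (k * v)) P := by
  have := hS.indep.isProbabilityMeasure
  induction k with
  | zero =>
    rw [Nat.cast_zero, zero_mul, isoGaussian_zero]
    exact hasLaw_dirac_of_ae_eq (by simp)
  | succ k ih =>
    have hsplit : (fun ω => S (i + (k + 1)) ω - S i ω) =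
        fun ω => (S (i + k) ω - S i ω) + (S (i + k + 1) ω - S (i + k) ω) := by
      ext1 ω
      rw [← add_assoc]
      abel
    rw [hsplit, Nat.cast_succ, add_mul, one_mul, ← isoGaussian_conv]
    refine IndepFun.hasLaw_fun_add ih (hS.law (i + k)) ?_
    exact (hS.indepFun_past (i + k) 1).comp
      (φ := fun x : Fin (i + k + 1) → Space d => x ⟨i + k, by omega⟩ - x ⟨i, by omega⟩) (ψ := id) (by fun_prop) measurable_id

end Walk

end GaussianWalk

end MobileGraph

namespace MobileGraph

open Filter Topology

/-! ### Void probabilities and the swept volume -/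

noncomputable section VoidProbability

variable {Ω : Type*} [MeasurableSpace Ω] {d : ℕ} {V : ℕ → Ω → Space d} {P : Measure Ω}
  {lam : ℝ≥0}

/-- The void probabilities of an independently marked Poisson point process. -/
lemma IsPoissonPointProcess.measure_forall_mark_notMem [IsProbabilityMeasure P]
    (h : IsPoissonPointProcess lam V P) {E : Type*} [MeasurableSpace E] {Z : ℕ → Ω → E}
    {Q : Measure E} [IsProbabilityMeasure Q] (hZ : ∀ k, Measurable (Z k))
    (hlaw : ∀ k, P.map (Z k) = Q) (hind : iIndepFun Z P)
    (hVZ : IndepFun (fun ω k => V k ω) (fun ω k => Z k ω) P) {H : Set (Space d × E)}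
    (hH : MeasurableSet H) (hfin : ∫⁻ y, Q {z | (y, z) ∈ H} ≠ ∞) :
    P {ω | ∀ k, (V k ω, Z k ω) ∉ H} =
      ENNReal.ofReal (Real.exp (-(lam * (∫⁻ y, Q {z | (y, z) ∈ H}).toReal))) := by
  have hQ : Measurable fun y => Q {z | (y, z) ∈ H} := measurable_measure_prodMk_left hH
  have hVm : Measurable fun ω k => V k ω := measurable_pi_lambda _ h.measurable
  have hZm : Measurable fun ω k => Z k ω := measurable_pi_lambda _ hZ
  rw [← h.lintegral_iInf_prod hQ (fun y => prob_le_one) hfin]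
  -- Given the locations, the first `K` marks are independent of law `Q`, so avoiding `H` has a
  -- product probability; the limit in `K` follows by monotonicity.
  have hfinset : ∀ K, P {ω | ∀ k ∈ Finset.range K, (V k ω, Z k ω) ∉ H} =
      ∫⁻ ω, ∏ k ∈ Finset.range K, (1 - Q {z | (V k ω, z) ∈ H}) ∂P := by
    intro K
    set A : Set ((ℕ → Space d) × (ℕ → E)) := {p | ∀ k ∈ Finset.range K, (p.1 k, p.2 k) ∉ H}
    have hA : MeasurableSet A := by
      have : A = ⋂ k ∈ Finset.range K,
          (fun p : (ℕ → Space d) × (ℕ → E) => (p.1 k, p.2 k)) ⁻¹' Hᶜ := by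
        ext p
        simp [A]
      rw [this]
      exact Finset.measurableSet_biInter _ fun k _ => hH.compl.preimage (by fun_prop)
    have hjoint : P.map (fun ω => ((fun k => V k ω), (fun k => Z k ω))) =
        (P.map fun ω k => V k ω).prod (Measure.infinitePi fun _ => Q) := by
      rw [hVZ.map_prod_eq_prod_map_map hVm.aemeasurable hZm.aemeasurable,
        (iIndepFun_iff_map_fun_eq_infinitePi_map hZ).1 hind]
      simp_rw [hlaw]
    have h1 : P {ω | ∀ k ∈ Finset.range K, (V k ω, Z k ω) ∉ H} =
        P.map (fun ω => ((fun k => V k ω), (fun k => Z k ω))) A := by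
      rw [Measure.map_apply (hVm.prodMk hZm) hA]
      rfl
    rw [h1, hjoint, Measure.prod_apply hA, lintegral_map (measurable_measure_prodMk_left hA) hVm]
    refine lintegral_congr fun ω => ?_
    have h2 : Prod.mk (fun k => V k ω) ⁻¹' A =
        (Finset.range K : Set ℕ).pi fun k => {z | (V k ω, z) ∈ H}ᶜ := by
      ext z
      simp [A, Set.mem_pi]
    have h3 : ∀ k, MeasurableSet {z | (V k ω, z) ∈ H} := fun k => measurable_prodMk_left hH
    rw [h2, Measure.infinitePi_pi _ fun k _ => (h3 k).compl]
    exact Finset.prod_congr rfl fun k _ => prob_compl_eq_one_sub (h3 k)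
  have hmeasset : ∀ K, MeasurableSet {ω | ∀ k ∈ Finset.range K, (V k ω, Z k ω) ∉ H} := by
    intro K
    have : {ω | ∀ k ∈ Finset.range K, (V k ω, Z k ω) ∉ H} =
        ⋂ k ∈ Finset.range K, (fun ω => (V k ω, Z k ω)) ⁻¹' Hᶜ := by
      ext ω
      simp
    rw [this]
    exact Finset.measurableSet_biInter _ fun k _ =>
      hH.compl.preimage ((h.measurable k).prodMk (hZ k))
  have hInter : {ω | ∀ k, (V k ω, Z k ω) ∉ H} =
      ⋂ K, {ω | ∀ k ∈ Finset.range K, (V k ω, Z k ω) ∉ H} := by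
    ext ω
    simp only [Set.mem_ofPred_eq, Set.mem_iInter, Finset.mem_range]
    exact ⟨fun hω K k _ => hω k, fun hω k => hω (k + 1) k (Nat.lt_succ_self k)⟩
  have hanti : ∀ ω, Antitone fun K => ∏ k ∈ Finset.range K, (1 - Q {z | (V k ω, z) ∈ H}) :=
    fun ω => antitone_prod_range fun k => tsub_le_self
  rw [hInter, Antitone.measure_iInter, lintegral_iInf]
  · exact iInf_congr hfinset
  · exact fun K => Finset.measurable_fun_prod _ fun k _ =>
      measurable_const.sub (hQ.comp (h.measurable k))
  · exact fun K L hKL ω => hanti ω hKL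
  · simp
  · exact fun K L hKL ω hω k hk => hω k (Finset.range_mono hKL hk)
  · exact fun K => (hmeasset K).nullMeasurableSet
  · exact ⟨0, measure_ne_top _ _⟩

/-- A node that starts at `y` and is displaced by the path `w` is within distance `r` of the path
`x` at one of the first `t` time steps. -/
def Hits (r : ℝ) (t : ℕ) (y : Space d) (w x : ℕ → Space d) : Prop :=
  ∃ i < t, dist (y + w i) (x i) ≤ r

lemma measurableSet_hits {α : Type*} [MeasurableSpace α] (r : ℝ) (t : ℕ) {f : α → Space d}
    {g h : α → ℕ → Space d} (hf : Measurable f) (hg : ∀ i, Measurable fun a => g a i)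
    (hh : ∀ i, Measurable fun a => h a i) : MeasurableSet {a | Hits r t (f a) (g a) (h a)} := by
  have : {a | Hits r t (f a) (g a) (h a)} =
      ⋃ i, ⋃ (_ : i < t), {a | dist (f a + g a i) (h a i) ≤ r} := by
    ext a
    simp [Hits]
  rw [this]
  exact MeasurableSet.iUnion fun i => MeasurableSet.iUnion fun _ =>
    measurableSet_le ((hf.add (hg i)).dist (hh i)) measurable_const

/-- The strict bound `i < t` in `Hits` matches the weak inequality for the detection time: step `t`
itself is not tested. -/
lemma coe_le_detectionTime_iff {Ω : Type*} {r : ℝ} {V : ℕ → Ω → Space d}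
    {W : ℕ → ℝ≥0 → Ω → Space d} {X : ℝ≥0 → Ω → Space d} {t : ℕ} {ω : Ω} :
    (t : ℕ∞) ≤ detectionTime r V W X ω ↔
      ∀ k, ¬ Hits r t (V k ω) (fun i => W k i ω) (fun i => X i ω) := by
  simp only [detectionTime, le_iInf_iff, Nat.cast_le, Detected, Hits, not_exists, not_and]
  constructor
  · intro h k i hi hd
    exact absurd (h i ⟨k, hd⟩) (not_le.2 hi)
  · rintro h i ⟨k, hd⟩
    by_contra hi
    exact h k i (not_le.1 hi) hd

/-- The mean volume swept in the first `t` time steps by a ball of radius `r` that moves like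
`x - w`, where `w` has the law `Q`. -/
def sweptVolume (Q : Measure (ℕ → Space d)) (r : ℝ) (t : ℕ) (x : ℕ → Space d) : ℝ≥0∞ :=
  ∫⁻ y, Q {w | Hits r t y w x}

lemma measurable_measure_hits (Q : Measure (ℕ → Space d)) [SFinite Q] (r : ℝ) (t : ℕ) :
    Measurable fun p : (ℕ → Space d) × Space d => Q {w | Hits r t p.2 w p.1} :=
  measurable_measure_prodMk_left
    (s := {q : ((ℕ → Space d) × Space d) × (ℕ → Space d) | Hits r t q.1.2 q.2 q.1.1})
    (measurableSet_hits r t (by fun_prop) (by fun_prop) (by fun_prop))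

lemma measurable_sweptVolume (Q : Measure (ℕ → Space d)) [SFinite Q] (r : ℝ) (t : ℕ) :
    Measurable (sweptVolume Q r t) :=
  (measurable_measure_hits Q r t).lintegral_prod_right'

/-- The positions at which a ball covers a random point have the volume of the ball on average. -/
lemma lintegral_measure_dist_le {α : Type*} [MeasurableSpace α] (μ : Measure α)
    [IsProbabilityMeasure μ] {S : α → Space d} (hS : Measurable S) (z : Space d) (r : ℝ) :
    ∫⁻ y, μ {a | dist (y + S a) z ≤ r} = volume (Metric.closedBall (0 : Space d) r) := by
  have hm : MeasurableSet {p : Space d × α | dist (p.1 + S p.2) z ≤ r} :=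
    measurableSet_le (by fun_prop) measurable_const
  have h1 := Measure.prod_apply (μ := (volume : Measure (Space d))) (ν := μ) hm
  have h2 := Measure.prod_apply_symm (μ := (volume : Measure (Space d))) (ν := μ) hm
  calc ∫⁻ y, μ {a | dist (y + S a) z ≤ r}
      = ∫⁻ a, volume {y | dist (y + S a) z ≤ r} ∂μ := h1.symm.trans h2
    _ = ∫⁻ _, volume (Metric.closedBall (0 : Space d) r) ∂μ := by
        refine lintegral_congr fun a => ?_
        have : {y | dist (y + S a) z ≤ r} = Metric.closedBall (z - S a) r := by
          ext y
          simp [dist_eq_norm, sub_sub_eq_add_sub]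
        rw [this, Measure.addHaar_closedBall_center]
    _ = _ := by simp

/-- Union bound over the times, each of which contributes the volume of one ball. It supplies
finiteness, and the right order for `d ≥ 3`. -/
lemma sweptVolume_le (Q : Measure (ℕ → Space d)) [IsProbabilityMeasure Q] (r : ℝ) (t : ℕ)
    (x : ℕ → Space d) :
    sweptVolume Q r t x ≤ t * volume (Metric.closedBall (0 : Space d) r) := by
  calc sweptVolume Q r t x
      ≤ ∫⁻ y, ∑ i ∈ Finset.range t, Q {w | dist (y + w i) (x i) ≤ r} := by
        refine lintegral_mono fun y => (measure_mono ?_).trans (measure_biUnion_finset_le _ _)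
        rintro w ⟨i, hi, hd⟩
        simp only [Set.mem_iUnion]
        exact ⟨i, Finset.mem_range.2 hi, hd⟩
    _ = ∑ i ∈ Finset.range t, ∫⁻ y, Q {w | dist (y + w i) (x i) ≤ r} := by
        refine lintegral_finsetSum _ fun i _ => ?_
        exact measurable_measure_prodMk_left (measurableSet_le
          (f := fun p : Space d × (ℕ → Space d) => dist (p.1 + p.2 i) (x i))
          (by fun_prop) measurable_const)
    _ = t * volume (Metric.closedBall (0 : Space d) r) := by
        rw [Finset.sum_congr rfl fun i _ =>
          lintegral_measure_dist_le Q (S := fun w : ℕ → Space d => w i) (by fun_prop) (x i) r]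
        simp

variable {s : ℝ} {W : ℕ → ℝ≥0 → Ω → Space d}

/-- The tail of the detection time of a target that is independent of the nodes. -/
lemma IsMobileGeometricGraph.measure_le_detectionTime [IsProbabilityMeasure P]
    (h : IsMobileGeometricGraph lam s V W P) (hs : 0 < s) (r : ℝ) {X : ℝ≥0 → Ω → Space d}
    (hX : ∀ u, Measurable (X u)) (hind : IsIndependentOfNodes X V W P) (t : ℕ) :
    P {ω | (t : ℕ∞) ≤ detectionTime r V W X ω} =
      ∫⁻ ω, ENNReal.ofReal (Real.exp (-(lam *
        (sweptVolume (P.map fun ω (i : ℕ) => W 0 i ω) r t fun i => X i ω).toReal))) ∂P := by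
  have hWm : ∀ k, Measurable fun ω (i : ℕ) => W k i ω := fun k =>
    measurable_pi_lambda _ fun i => (h.brownian k).measurable i
  set Q := P.map fun ω (i : ℕ) => W 0 i ω with hQ
  have : IsProbabilityMeasure Q := Measure.isProbabilityMeasure_map (hWm 0).aemeasurable
  -- All displacements have the same law at integer times, since the variance of the steps
  -- determines the law of a Gaussian walk.
  have hlaw : ∀ k, P.map (fun ω (i : ℕ) => W k i ω) = Q := fun k => by
    rw [hQ, ((h.brownian k).isGaussianWalk hs).map_eq, ((h.brownian 0).isGaussianWalk hs).map_eq]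
  have hWind : iIndepFun (fun k ω (i : ℕ) => W k i ω) P :=
    h.indep_motions.comp (fun _ (b : ℝ≥0 → Space d) (i : ℕ) => b i) fun _ => by fun_prop
  have hVW : IndepFun (fun ω k => V k ω) (fun ω k (i : ℕ) => W k i ω) P :=
    h.indep_initial.comp (φ := id) (ψ := fun (b : ℕ → ℝ≥0 → Space d) k (i : ℕ) => b k i)
      measurable_id (by fun_prop)
  have hXm : Measurable fun ω (i : ℕ) => X i ω := measurable_pi_lambda _ fun i => hX i
  have hVWm : Measurable fun ω => ((fun k => V k ω), (fun k (i : ℕ) => W k i ω)) :=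
    (measurable_pi_lambda _ h.poisson.measurable).prodMk (measurable_pi_lambda _ hWm)
  have hXVW : IndepFun (fun ω (i : ℕ) => X i ω)
      (fun ω => ((fun k => V k ω), (fun k (i : ℕ) => W k i ω))) P :=
    IndepFun.comp hind (φ := fun (x : ℝ≥0 → Space d) (i : ℕ) => x i)
      (ψ := fun (p : (ℕ → Space d) × (ℕ → ℝ≥0 → Space d)) =>
        (p.1, fun k (i : ℕ) => p.2 k i)) (by fun_prop) (by fun_prop)
  set A : Set ((ℕ → Space d) × (ℕ → Space d) × (ℕ → ℕ → Space d)) :=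
    {p | ∀ k, ¬ Hits r t (p.2.1 k) (p.2.2 k) p.1} with hA_def
  have hA : MeasurableSet A := by
    have : A = ⋂ k, {p | Hits r t (p.2.1 k) (p.2.2 k) p.1}ᶜ := by
      ext p
      simp [A]
    rw [this]
    exact MeasurableSet.iInter fun k =>
      (measurableSet_hits r t (by fun_prop) (by fun_prop) (by fun_prop)).compl
  have hset : {ω | (t : ℕ∞) ≤ detectionTime r V W X ω} =
      (fun ω => ((fun (i : ℕ) => X i ω), (fun k => V k ω), (fun k (i : ℕ) => W k i ω))) ⁻¹' A := by
    ext ω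
    exact coe_le_detectionTime_iff
  -- By independence and Fubini, the path of the target may be frozen, which leaves a void
  -- probability.
  rw [hset, ← Measure.map_apply (hXm.prodMk hVWm) hA,
    hXVW.map_prod_eq_prod_map_map hXm.aemeasurable hVWm.aemeasurable, Measure.prod_apply hA,
    lintegral_map (measurable_measure_prodMk_left hA) hXm]
  refine lintegral_congr fun ω => ?_
  rw [Measure.map_apply hVWm (measurable_prodMk_left hA)]
  set x : ℕ → Space d := fun i => X i ω
  have hH : MeasurableSet {p : Space d × (ℕ → Space d) | Hits r t p.1 p.2 x} :=
    measurableSet_hits r t (by fun_prop) (by fun_prop) (by fun_prop)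
  exact h.poisson.measure_forall_mark_notMem hWm hlaw hWind hVW hH
    (ne_top_of_le_ne_top (ENNReal.mul_ne_top (ENNReal.natCast_ne_top t)
      Metric.isBounded_closedBall.measure_lt_top.ne) (sweptVolume_le Q r t x))

/-- A lower bound of the swept volume yields an upper bound of the tail. -/
lemma IsMobileGeometricGraph.measure_le_detectionTime_le [IsProbabilityMeasure P]
    (h : IsMobileGeometricGraph lam s V W P) (hs : 0 < s) (r : ℝ) {X : ℝ≥0 → Ω → Space d}
    (hX : ∀ u, Measurable (X u)) (hind : IsIndependentOfNodes X V W P) (t : ℕ) {m : ℝ}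
    (hm : ∀ x, ENNReal.ofReal m ≤ sweptVolume (P.map fun ω (i : ℕ) => W 0 i ω) r t x) :
    P.real {ω | (t : ℕ∞) ≤ detectionTime r V W X ω} ≤ Real.exp (-(lam * m)) := by
  have hWm : Measurable fun ω (i : ℕ) => W 0 i ω :=
    measurable_pi_lambda _ fun i => (h.brownian 0).measurable i
  have := Measure.isProbabilityMeasure_map (μ := P) hWm.aemeasurable
  refine ENNReal.toReal_le_of_le_ofReal (Real.exp_pos _).le ?_
  rw [h.measure_le_detectionTime hs r hX hind t]
  calc _ ≤ ∫⁻ _, ENNReal.ofReal (Real.exp (-(lam * m))) ∂P := by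
        refine lintegral_mono fun ω => ENNReal.ofReal_le_ofReal (Real.exp_le_exp.2 ?_)
        refine neg_le_neg (mul_le_mul_of_nonneg_left ?_ lam.2)
        refine (ENNReal.ofReal_le_iff_le_toReal ?_).1 (hm _)
        exact ne_top_of_le_ne_top (ENNReal.mul_ne_top (ENNReal.natCast_ne_top t)
          Metric.isBounded_closedBall.measure_lt_top.ne) (sweptVolume_le _ r t _)
    _ = _ := by simp

/-- The mean swept volume of the path of a target that is independent of the nodes. -/
lemma IsMobileGeometricGraph.lintegral_sweptVolume [IsProbabilityMeasure P]
    (h : IsMobileGeometricGraph lam s V W P) (r : ℝ) {X : ℝ≥0 → Ω → Space d}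
    (hX : ∀ u, Measurable (X u)) (hind : IsIndependentOfNodes X V W P) (t : ℕ) :
    ∫⁻ ω, sweptVolume (P.map fun ω (i : ℕ) => W 0 i ω) r t (fun i => X i ω) ∂P =
      ∫⁻ y, P {ω | Hits r t y (fun i => W 0 i ω - X i ω) 0} := by
  have hWm : Measurable fun ω (i : ℕ) => W 0 i ω :=
    measurable_pi_lambda _ fun i => (h.brownian 0).measurable i
  have hXm : Measurable fun ω (i : ℕ) => X i ω := measurable_pi_lambda _ fun i => hX i
  have := Measure.isProbabilityMeasure_map (μ := P) hWm.aemeasurable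
  set Q := P.map fun ω (i : ℕ) => W 0 i ω with hQ
  have hXW : IndepFun (fun ω (i : ℕ) => X i ω) (fun ω (i : ℕ) => W 0 i ω) P :=
    IndepFun.comp hind (φ := fun (x : ℝ≥0 → Space d) (i : ℕ) => x i)
      (ψ := fun (p : (ℕ → Space d) × (ℕ → ℝ≥0 → Space d)) (i : ℕ) => p.2 0 i)
      (by fun_prop) (by fun_prop)
  simp_rw [sweptVolume]
  rw [lintegral_lintegral_swap (f := fun ω y => Q {w | Hits r t y w fun i : ℕ => X i ω})
    ((measurable_measure_hits Q r t).comp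
      ((hXm.comp measurable_fst).prodMk measurable_snd)).aemeasurable]
  refine lintegral_congr fun y => ?_
  have hA : MeasurableSet {p : (ℕ → Space d) × (ℕ → Space d) | Hits r t y p.2 p.1} :=
    measurableSet_hits r t (by fun_prop) (by fun_prop) (by fun_prop)
  -- Only the relative displacement matters: the moving target becomes a fixed one at the origin.
  have hset : {ω | Hits r t y (fun i => W 0 i ω - X i ω) 0} =
      (fun ω => ((fun (i : ℕ) => X i ω), fun (i : ℕ) => W 0 i ω)) ⁻¹' {p | Hits r t y p.2 p.1} := by
    ext ω
    simp only [Hits, Set.mem_ofPred_eq, Set.mem_preimage, Pi.zero_apply,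
      dist_eq_norm, add_sub_assoc]
    simp only [sub_zero]
  rw [hset, ← Measure.map_apply (hXm.prodMk hWm) hA,
    hXW.map_prod_eq_prod_map_map hXm.aemeasurable hWm.aemeasurable, Measure.prod_apply hA,
    lintegral_map (measurable_measure_prodMk_left hA) hXm]
  rfl

/-- An upper bound of the mean swept volume yields a lower bound of the tail. -/
lemma IsMobileGeometricGraph.le_measure_le_detectionTime [IsProbabilityMeasure P]
    (h : IsMobileGeometricGraph lam s V W P) (hs : 0 < s) (r : ℝ) {X : ℝ≥0 → Ω → Space d}
    (hX : ∀ u, Measurable (X u)) (hind : IsIndependentOfNodes X V W P) (t : ℕ) {m : ℝ}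
    (hm0 : 0 ≤ m)
    (hm : ∫⁻ y, P {ω | Hits r t y (fun i => W 0 i ω - X i ω) 0} ≤ ENNReal.ofReal m) :
    Real.exp (-(lam * m)) ≤ P.real {ω | (t : ℕ∞) ≤ detectionTime r V W X ω} := by
  have hWm : Measurable fun ω (i : ℕ) => W 0 i ω :=
    measurable_pi_lambda _ fun i => (h.brownian 0).measurable i
  have hXm : Measurable fun ω (i : ℕ) => X i ω := measurable_pi_lambda _ fun i => hX i
  have := Measure.isProbabilityMeasure_map (μ := P) hWm.aemeasurable
  rw [← h.lintegral_sweptVolume r hX hind t] at hm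
  set Φ : Ω → ℝ≥0∞ := fun ω => sweptVolume (P.map fun ω (i : ℕ) => W 0 i ω) r t fun i => X i ω
  have hΦm : Measurable Φ := (measurable_sweptVolume _ r t).comp hXm
  have hint : Integrable (fun ω => (Φ ω).toReal) P :=
    integrable_toReal_of_lintegral_ne_top hΦm.aemeasurable
      (ne_top_of_le_ne_top ENNReal.ofReal_ne_top hm)
  have hmean : ∫ ω, (Φ ω).toReal ∂P ≤ m := by
    rw [integral_toReal hΦm.aemeasurable (ae_lt_top hΦm (ne_top_of_le_ne_top
      ENNReal.ofReal_ne_top hm))]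
    exact ENNReal.toReal_le_of_le_ofReal hm0 hm
  have hexp : Integrable (fun ω => Real.exp (-(lam * (Φ ω).toReal))) P :=
    Integrable.of_bound (Real.measurable_exp.comp
      (hΦm.ennreal_toReal.const_mul _).neg).aestronglyMeasurable 1 (ae_of_all _ fun ω => by
      rw [Real.norm_eq_abs, abs_of_pos (Real.exp_pos _), Real.exp_le_one_iff]
      exact neg_nonpos.2 (by positivity))
  rw [Measure.real, h.measure_le_detectionTime hs r hX hind t,
    ← integral_eq_lintegral_of_nonneg_ae (ae_of_all _ fun ω => (Real.exp_pos _).le)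
      hexp.aestronglyMeasurable]
  -- Jensen's inequality by hand: `exp (-u)` lies above its tangent at `u = lam * m`, and a mean
  -- below `m` only helps because the tangent decreases.
  calc Real.exp (-(lam * m))
      ≤ ∫ ω, Real.exp (-(lam * m)) * (1 + lam * m - lam * (Φ ω).toReal) ∂P := by
        rw [integral_const_mul, integral_sub (integrable_const _) (hint.const_mul _),
          integral_const_mul]
        simp only [integral_const, probReal_univ, smul_eq_mul, one_mul]
        refine le_mul_of_one_le_right (Real.exp_pos _).le ?_
        have := mul_le_mul_of_nonneg_left hmean lam.2
        change (lam : ℝ) * _ ≤ lam * _ at this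
        linarith
    _ ≤ ∫ ω, Real.exp (-(lam * (Φ ω).toReal)) ∂P := by
        refine integral_mono (((integrable_const _).sub (hint.const_mul _)).const_mul _) hexp
          fun ω => ?_
        have h1 := Real.add_one_le_exp (lam * m - lam * (Φ ω).toReal)
        have h2 : Real.exp (-(lam * (Φ ω).toReal)) =
            Real.exp (-(lam * m)) * Real.exp (lam * m - lam * (Φ ω).toReal) := by
          rw [← Real.exp_add]
          ring_nf
        simp only [h2]
        exact mul_le_mul_of_nonneg_left (by linarith) (Real.exp_pos _).le

end VoidProbability

end MobileGraph

namespace MobileGraph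

open Filter Topology

/-! ### Gaussian ball estimates and the first and second moments of the number of visits -/

noncomputable section Estimates

/-- A Gaussian law gives to an interval at most its length times the maximal density. -/
lemma gaussianReal_Icc_le {v : ℝ≥0} (hv : v ≠ 0) (a b : ℝ) :
    gaussianReal 0 v (Set.Icc a b) ≤ ENNReal.ofReal ((b - a) * (√(2 * Real.pi * v))⁻¹) := by
  rw [gaussianReal_apply _ hv]
  calc ∫⁻ x in Set.Icc a b, gaussianPDF 0 v x
      ≤ ∫⁻ _ in Set.Icc a b, ENNReal.ofReal (√(2 * Real.pi * v))⁻¹ := by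
        refine lintegral_mono fun x => ENNReal.ofReal_le_ofReal ?_
        rw [gaussianPDFReal]
        refine mul_le_of_le_one_right (by positivity) (Real.exp_le_one_iff.2 ?_)
        exact div_nonpos_of_nonpos_of_nonneg (neg_nonpos.2 (sq_nonneg _)) (by positivity)
    _ = _ := by
        rw [setLIntegral_const, Real.volume_Icc, mul_comm, ← ENNReal.ofReal_mul' (by positivity)]

/-- On a centred interval the density is smallest at the endpoints. -/
lemma le_gaussianReal_Icc {v : ℝ≥0} (hv : v ≠ 0) {a : ℝ} (ha : 0 ≤ a) :
    ENNReal.ofReal (2 * a * ((√(2 * Real.pi * v))⁻¹ * Real.exp (-(a ^ 2) / (2 * v)))) ≤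
      gaussianReal 0 v (Set.Icc (-a) a) := by
  rw [gaussianReal_apply _ hv]
  calc ENNReal.ofReal (2 * a * ((√(2 * Real.pi * v))⁻¹ * Real.exp (-(a ^ 2) / (2 * v))))
      = ∫⁻ _ in Set.Icc (-a) a,
          ENNReal.ofReal ((√(2 * Real.pi * v))⁻¹ * Real.exp (-(a ^ 2) / (2 * v))) := by
        rw [setLIntegral_const, Real.volume_Icc, mul_comm, ← ENNReal.ofReal_mul' (by linarith)]
        ring_nf
    _ ≤ _ := by
        refine setLIntegral_mono (measurable_gaussianPDF _ _) fun x hx =>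
          ENNReal.ofReal_le_ofReal ?_
        rw [gaussianPDFReal, sub_zero]
        have : x ^ 2 ≤ a ^ 2 := sq_le_sq' hx.1 hx.2
        gcongr

/-- The ball lies in a cube of side `2 * ρ`. The bound does not depend on the centre, which makes
the later estimates uniform in the target's path. -/
lemma isoGaussian_closedBall_le {d : ℕ} {v : ℝ≥0} (hv : v ≠ 0) (z : Space d) (ρ : ℝ) :
    isoGaussian d v (Metric.closedBall z ρ) ≤
      ENNReal.ofReal (2 * ρ * (√(2 * Real.pi * v))⁻¹) ^ d := by
  rw [isoGaussian, Measure.map_apply (WithLp.measurable_toLp 2 _)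
    Metric.isClosed_closedBall.measurableSet]
  calc _ ≤ (Measure.pi fun _ : Fin d => gaussianReal 0 v)
          (Set.univ.pi fun j => Set.Icc (z j - ρ) (z j + ρ)) := by
        refine measure_mono fun x hx j _ => ?_
        have h1 := PiLp.norm_apply_le (p := 2) (WithLp.toLp 2 x - z) j
        rw [Set.mem_preimage, Metric.mem_closedBall, dist_eq_norm] at hx
        have h2 := abs_le.1 (h1.trans hx)
        simp only [PiLp.sub_apply] at h2
        constructor <;> linarith [h2.1, h2.2]
    _ = ∏ j : Fin d, gaussianReal 0 v (Set.Icc (z j - ρ) (z j + ρ)) := Measure.pi_pi _ _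
    _ ≤ ∏ _j : Fin d, ENNReal.ofReal (2 * ρ * (√(2 * Real.pi * v))⁻¹) := by
        refine Finset.prod_le_prod' fun j _ => (gaussianReal_Icc_le hv _ _).trans_eq ?_
        congr 2
        ring
    _ = _ := by simp

/-- The ball contains the square of half-side `ρ / 2`. Only the plane is needed: for `d ≥ 3` the
union bound suffices. -/
lemma le_isoGaussian_closedBall {v : ℝ≥0} (hv : v ≠ 0) {ρ : ℝ} (hρ : 0 ≤ ρ) :
    ENNReal.ofReal (ρ * ((√(2 * Real.pi * v))⁻¹ * Real.exp (-((ρ / 2) ^ 2) / (2 * v)))) ^ 2 ≤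
      isoGaussian 2 v (Metric.closedBall 0 ρ) := by
  rw [isoGaussian, Measure.map_apply (WithLp.measurable_toLp 2 _)
    Metric.isClosed_closedBall.measurableSet]
  calc _ = ∏ _j : Fin 2, ENNReal.ofReal
          (2 * (ρ / 2) * ((√(2 * Real.pi * v))⁻¹ * Real.exp (-((ρ / 2) ^ 2) / (2 * v)))) := by
        rw [mul_div_cancel₀ _ (two_ne_zero' ℝ)]
        simp
    _ ≤ ∏ _j : Fin 2, gaussianReal 0 v (Set.Icc (-(ρ / 2)) (ρ / 2)) :=
        Finset.prod_le_prod' fun j _ => le_gaussianReal_Icc hv (by linarith)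
    _ = (Measure.pi fun _ : Fin 2 => gaussianReal 0 v)
          (Set.univ.pi fun _ => Set.Icc (-(ρ / 2)) (ρ / 2)) := (Measure.pi_pi _ _).symm
    _ ≤ _ := by
        refine measure_mono fun x hx => ?_
        rw [Set.mem_preimage, mem_closedBall_zero_iff, EuclideanSpace.norm_eq,
          Real.sqrt_le_left hρ, Fin.sum_univ_two]
        have h0 := hx 0 trivial
        have h1 := hx 1 trivial
        simp only [Real.norm_eq_abs, sq_abs]
        nlinarith [sq_le_sq' h0.1 h0.2, sq_le_sq' h1.1 h1.2]

variable {Ω : Type*} [MeasurableSpace Ω] {d : ℕ} {v : ℝ≥0} {S : ℕ → Ω → Space d} {P : Measure Ω}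

lemma measurableSet_dist_le (hS : ∀ i, Measurable (S i)) (y z : Space d) (i : ℕ) (r : ℝ) :
    MeasurableSet {ω | dist (y + S i ω) z ≤ r} :=
  measurableSet_le ((measurable_const.add (hS i)).dist measurable_const) measurable_const

/-- After the first visit to a ball of radius `r`, a walk spends a fixed mean time in the ball of
radius `2 r`. -/
lemma IsGaussianWalk.sum_mul_measure_hits_le (hS : IsGaussianWalk v S P) (r : ℝ) (t : ℕ)
    (y : Space d) :
    (∑ k ∈ Finset.range t, isoGaussian d (k * v) (Metric.closedBall 0 r)) *
        P {ω | Hits r t y (fun i => S i ω) 0} ≤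
      ∑ n ∈ Finset.range (2 * t), P {ω | dist (y + S n ω) 0 ≤ 2 * r} := by
  -- The first visit occurs at time `i`; these events are disjoint and each depends only on the walk
  -- up to time `i`.
  set F : ℕ → Set Ω := fun i =>
    {ω | dist (y + S i ω) 0 ≤ r ∧ ∀ j < i, ¬ dist (y + S j ω) 0 ≤ r} with hF
  set A : ℕ → Set Ω := fun n => {ω | dist (y + S n ω) 0 ≤ 2 * r} with hA
  have hAm : ∀ n, MeasurableSet (A n) := fun n => measurableSet_dist_le hS.measurable y 0 n _
  have hFm : ∀ i, MeasurableSet (F i) := by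
    intro i
    have : F i = {ω | dist (y + S i ω) 0 ≤ r} ∩ ⋂ j, ⋂ (_ : j < i), {ω | dist (y + S j ω) 0 ≤ r}ᶜ := by
      ext ω
      simp [hF]
    rw [this]
    exact (measurableSet_dist_le hS.measurable y 0 i _).inter (MeasurableSet.iInter fun j =>
      MeasurableSet.iInter fun _ => (measurableSet_dist_le hS.measurable y 0 j _).compl)
  have hFdisj : Pairwise (Function.onFun Disjoint F) := by
    intro i j hij
    rw [Function.onFun, Set.disjoint_left]
    rintro ω ⟨hi, hi'⟩ ⟨hj, hj'⟩
    rcases lt_or_gt_of_ne hij with h | h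
    · exact hj' i h hi
    · exact hi' j h hj
  have hcover : P {ω | Hits r t y (fun i => S i ω) 0} ≤ ∑ i ∈ Finset.range t, P (F i) := by
    refine (measure_mono ?_).trans (measure_biUnion_finset_le _ _)
    rintro ω ⟨i, hi, hd⟩
    classical
    have hex : ∃ i, dist (y + S i ω) 0 ≤ r := ⟨i, hd⟩
    simp only [Set.mem_iUnion]
    exact ⟨Nat.find hex, Finset.mem_range.2 ((Nat.find_min' hex hd).trans_lt hi),
      Nat.find_spec hex, fun j hj => Nat.find_min hex hj⟩
  -- The Markov property at the first visit: an independent increment of norm at most `r` keeps the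
  -- walk in the doubled ball.
  have hstep : ∀ i k : ℕ, isoGaussian d (k * v) (Metric.closedBall 0 r) * P (F i) ≤
      P (F i ∩ A (i + k)) := by
    intro i k
    set B : Set (Fin (i + 1) → Space d) := {x | dist (y + x ⟨i, Nat.lt_succ_self i⟩) 0 ≤ r ∧
      ∀ j : Fin (i + 1), j.1 < i → ¬ dist (y + x j) 0 ≤ r} with hB
    have hBm : MeasurableSet B := by
      have : B = {x | dist (y + x ⟨i, Nat.lt_succ_self i⟩) 0 ≤ r} ∩
          ⋂ j : Fin (i + 1), ⋂ (_ : j.1 < i), {x | dist (y + x j) 0 ≤ r}ᶜ := by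
        ext x
        simp [hB]
      rw [this]
      have hm : ∀ j : Fin (i + 1),
          MeasurableSet {x : Fin (i + 1) → Space d | dist (y + x j) 0 ≤ r} :=
        fun j => measurableSet_le (by fun_prop) measurable_const
      exact (hm _).inter (MeasurableSet.iInter fun j => MeasurableSet.iInter fun _ => (hm j).compl)
    have hFB : F i = (fun ω (j : Fin (i + 1)) => S j ω) ⁻¹' B := by
      ext ω
      refine and_congr Iff.rfl ⟨fun h j hj => h j hj, fun h j hj => h ⟨j, by omega⟩ hj⟩
    have hball : MeasurableSet (Metric.closedBall (0 : Space d) r) :=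
      Metric.isClosed_closedBall.measurableSet
    have hmul := (hS.indepFun_past i k).measure_inter_preimage_eq_mul B (Metric.closedBall 0 r)
      hBm hball
    rw [← hFB] at hmul
    rw [← (hS.hasLaw_sub i k).map_eq, Measure.map_apply_of_aemeasurable
      (hS.hasLaw_sub i k).aemeasurable hball, mul_comm, ← hmul]
    refine measure_mono fun ω hω => ⟨hω.1, ?_⟩
    have h1 : ‖y + S i ω‖ ≤ r := by simpa using hω.1.1
    have h2 : ‖S (i + k) ω - S i ω‖ ≤ r := by simpa using hω.2
    change dist (y + S (i + k) ω) 0 ≤ 2 * r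
    rw [dist_zero_right]
    calc ‖y + S (i + k) ω‖ = ‖(y + S i ω) + (S (i + k) ω - S i ω)‖ := by congr 1; abel
      _ ≤ 2 * r := (norm_add_le _ _).trans (by linarith)
  calc _ ≤ (∑ k ∈ Finset.range t, isoGaussian d (k * v) (Metric.closedBall 0 r)) *
          ∑ i ∈ Finset.range t, P (F i) := by gcongr
    _ = ∑ i ∈ Finset.range t, ∑ k ∈ Finset.range t,
          isoGaussian d (k * v) (Metric.closedBall 0 r) * P (F i) := by
        rw [Finset.sum_mul_sum, Finset.sum_comm]
    _ ≤ ∑ i ∈ Finset.range t, ∑ n ∈ Finset.range (2 * t), P (F i ∩ A n) := by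
        refine Finset.sum_le_sum fun i hi => ?_
        have hi' := Finset.mem_range.1 hi
        calc _ ≤ ∑ k ∈ Finset.range t, P (F i ∩ A (i + k)) :=
              Finset.sum_le_sum fun k _ => hstep i k
          _ = ∑ n ∈ Finset.Ico i (i + t), P (F i ∩ A n) := by
              rw [Finset.sum_Ico_eq_sum_range, Nat.add_sub_cancel_left]
          _ ≤ _ := by
              refine Finset.sum_le_sum_of_subset fun n hn => ?_
              rw [Finset.mem_Ico] at hn
              rw [Finset.mem_range]
              omega
    _ = ∑ n ∈ Finset.range (2 * t), ∑ i ∈ Finset.range t, P (F i ∩ A n) := Finset.sum_comm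
    _ ≤ ∑ n ∈ Finset.range (2 * t), P (A n) := by
        refine Finset.sum_le_sum fun n _ => ?_
        rw [← measure_biUnion_finset
          (fun i _ j _ hij => (hFdisj hij).mono Set.inter_subset_left Set.inter_subset_left)
          fun i _ => (hFm i).inter (hAm n)]
        exact measure_mono (Set.iUnion₂_subset fun i _ => Set.inter_subset_right)

lemma IsGaussianWalk.sum_mul_lintegral_hits_le (hS : IsGaussianWalk v S P) (r : ℝ) (t : ℕ) :
    (∑ k ∈ Finset.range t, isoGaussian d (k * v) (Metric.closedBall 0 r)) *
        ∫⁻ y, P {ω | Hits r t y (fun i => S i ω) 0} ≤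
      2 * t * volume (Metric.closedBall (0 : Space d) (2 * r)) := by
  have := hS.indep.isProbabilityMeasure
  have hm : Measurable fun y : Space d => P {ω | Hits r t y (fun i => S i ω) 0} :=
    measurable_measure_prodMk_left (s := {p : Space d × Ω | Hits r t p.1 (fun i => S i p.2) 0})
      (measurableSet_hits r t measurable_fst (fun i => (hS.measurable i).comp measurable_snd)
        fun i => measurable_const)
  rw [← lintegral_const_mul _ hm]
  calc _ ≤ ∫⁻ y, ∑ n ∈ Finset.range (2 * t), P {ω | dist (y + S n ω) 0 ≤ 2 * r} :=
        lintegral_mono fun y => hS.sum_mul_measure_hits_le r t y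
    _ = ∑ n ∈ Finset.range (2 * t), ∫⁻ y, P {ω | dist (y + S n ω) 0 ≤ 2 * r} := by
        refine lintegral_finsetSum _ fun n _ => ?_
        exact measurable_measure_prodMk_left (measurableSet_le
          (f := fun p : Space d × Ω => dist (p.1 + S n p.2) 0)
          ((measurable_fst.add ((hS.measurable n).comp measurable_snd)).dist measurable_const)
          measurable_const)
    _ = _ := by
        rw [Finset.sum_congr rfl fun n _ => lintegral_measure_dist_le P (hS.measurable n) 0 (2 * r)]
        simp

/-- A pointwise substitute for Cauchy–Schwarz in the second moment method, free of subtraction. -/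
lemma two_mul_le_one_add_sq_ennreal (u : ℝ≥0∞) : 2 * u ≤ 1 + u ^ 2 := by
  rcases eq_or_ne u ∞ with rfl | hu
  · simp
  · lift u to ℝ≥0 using hu
    norm_cast
    rw [← NNReal.coe_le_coe]
    push_cast
    nlinarith [sq_nonneg ((u : ℝ) - 1)]

/-- The number of visits to a ball has, by the second moment method, a lower bound of the
mean of its support. -/
lemma le_lintegral_measure_hits [IsProbabilityMeasure P] (hS : ∀ i, Measurable (S i)) {r : ℝ}
    (hr : volume (Metric.closedBall (0 : Space d) r) = 1) (t : ℕ) (x : ℕ → Space d) {K : ℝ}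
    (hK : 0 < K)
    (hsum : ∀ i < t, ∑ j ∈ Finset.range t, P {ω | dist (S i ω - x i) (S j ω - x j) ≤ 2 * r} ≤
      ENNReal.ofReal K) :
    ENNReal.ofReal (t / K) ≤ ∫⁻ y, P {ω | Hits r t y (fun i => S i ω) x} := by
  set μ : Measure (Space d × Ω) := (volume : Measure (Space d)).prod P with hμ
  set A : ℕ → Set (Space d × Ω) := fun i => {p | dist (p.1 + S i p.2) (x i) ≤ r} with hA
  have hAm : ∀ i, MeasurableSet (A i) := fun i =>
    measurableSet_le ((measurable_fst.add ((hS i).comp measurable_snd)).dist measurable_const)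
      measurable_const
  have hAμ : ∀ i, μ (A i) = 1 := fun i => by
    rw [hμ, Measure.prod_apply (hAm i), ← hr, ← lintegral_measure_dist_le P (hS i) (x i) r]
    rfl
  -- Visits at both times bring the two relative positions within `2 * r`; given that, the starting
  -- points fill at most one ball of volume `1`.
  have hAA : ∀ i j, μ (A i ∩ A j) ≤ P {ω | dist (S i ω - x i) (S j ω - x j) ≤ 2 * r} := by
    intro i j
    have hDm : MeasurableSet {ω | dist (S i ω - x i) (S j ω - x j) ≤ 2 * r} :=
      measurableSet_le (((hS i).sub measurable_const).dist ((hS j).sub measurable_const))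
        measurable_const
    rw [hμ, Measure.prod_apply_symm ((hAm i).inter (hAm j)), ← lintegral_indicator_one hDm]
    refine lintegral_mono fun ω => ?_
    by_cases hω : dist (S i ω - x i) (S j ω - x j) ≤ 2 * r
    · rw [Set.indicator_of_mem (s := {ω | dist (S i ω - x i) (S j ω - x j) ≤ 2 * r}) hω]
      calc _ ≤ volume (Metric.closedBall (x i - S i ω) r) := by
            refine measure_mono fun y hy => ?_
            have : dist (y + S i ω) (x i) ≤ r := hy.1
            rw [Metric.mem_closedBall]
            simpa [dist_eq_norm, sub_sub_eq_add_sub] using this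
        _ = 1 := by rw [Measure.addHaar_closedBall_center, hr]
    · rw [show (fun y => (y, ω)) ⁻¹' (A i ∩ A j) = ∅ from ?_]
      · simp
      · refine Set.eq_empty_of_forall_notMem fun y hy => hω ?_
        have h1 : dist (y + S i ω) (x i) ≤ r := hy.1
        have h2 : dist (y + S j ω) (x j) ≤ r := hy.2
        rw [dist_eq_norm] at h1 h2 ⊢
        calc ‖S i ω - x i - (S j ω - x j)‖
            = ‖(y + S i ω - x i) - (y + S j ω - x j)‖ := by congr 1; abel
          _ ≤ 2 * r := (norm_sub_le _ _).trans (by linarith)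
  set N : Space d × Ω → ℝ≥0∞ := fun p => ∑ i ∈ Finset.range t, (A i).indicator 1 p with hN
  have hNm : Measurable N := Finset.measurable_fun_sum _ fun i _ =>
    measurable_one.indicator (hAm i)
  have hN1 : ∫⁻ p, N p ∂μ = t := by
    rw [hN, lintegral_finsetSum _ fun i _ => measurable_one.indicator (hAm i)]
    simp_rw [lintegral_indicator_one (hAm _), hAμ]
    simp
  have hN2 : ∫⁻ p, N p ^ 2 ∂μ ≤ t * ENNReal.ofReal K := by
    have hsq : ∀ p, N p ^ 2 =
        ∑ i ∈ Finset.range t, ∑ j ∈ Finset.range t, (A i ∩ A j).indicator 1 p := fun p => by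
      rw [hN, sq, Finset.sum_mul_sum]
      simp_rw [Set.inter_indicator_one, Pi.mul_apply]
    simp_rw [hsq]
    rw [lintegral_finsetSum _ fun i _ => Finset.measurable_fun_sum _ fun j _ =>
      measurable_one.indicator ((hAm i).inter (hAm j))]
    calc _ ≤ ∑ i ∈ Finset.range t, ENNReal.ofReal K := by
          refine Finset.sum_le_sum fun i hi => ?_
          rw [lintegral_finsetSum _ fun j _ => measurable_one.indicator ((hAm i).inter (hAm j))]
          simp_rw [lintegral_indicator_one ((hAm i).inter (hAm _))]
          exact (Finset.sum_le_sum fun j _ => hAA i j).trans (hsum i (Finset.mem_range.1 hi))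
      _ = _ := by simp
  have hHm : MeasurableSet {p : Space d × Ω | Hits r t p.1 (fun i => S i p.2) x} :=
    measurableSet_hits r t measurable_fst (fun i => (hS i).comp measurable_snd)
      fun i => measurable_const
  have hH : ∫⁻ y, P {ω | Hits r t y (fun i => S i ω) x} =
      ∫⁻ p, {p : Space d × Ω | Hits r t p.1 (fun i => S i p.2) x}.indicator 1 p ∂μ := by
    rw [lintegral_indicator_one hHm, hμ, Measure.prod_apply hHm]
    rfl
  -- The weight `1 / K` maximizes `2 * a * t - a ^ 2 * t * K`, with value `t / K`.
  set a : ℝ≥0∞ := ENNReal.ofReal K⁻¹ with ha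
  have haK : a * ENNReal.ofReal K = 1 := by
    rw [ha, ← ENNReal.ofReal_mul (by positivity), inv_mul_cancel₀ hK.ne', ENNReal.ofReal_one]
  have hpt : ∀ p, 2 * a * N p ≤
      {p : Space d × Ω | Hits r t p.1 (fun i => S i p.2) x}.indicator 1 p + a ^ 2 * N p ^ 2 := by
    intro p
    by_cases hp : Hits r t p.1 (fun i => S i p.2) x
    · rw [Set.indicator_of_mem
        (s := {p : Space d × Ω | Hits r t p.1 (fun i => S i p.2) x}) hp, Pi.one_apply,
        ← mul_pow, mul_assoc]
      exact two_mul_le_one_add_sq_ennreal _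
    · have : N p = 0 := by
        refine Finset.sum_eq_zero fun i hi => Set.indicator_of_notMem (fun hi' => hp ?_) _
        exact ⟨i, Finset.mem_range.1 hi, hi'⟩
      rw [this]
      simp
  have hmain : 2 * a * t ≤ (∫⁻ y, P {ω | Hits r t y (fun i => S i ω) x}) + a * t := by
    calc 2 * a * t = ∫⁻ p, 2 * a * N p ∂μ := by rw [lintegral_const_mul _ hNm, hN1]
      _ ≤ ∫⁻ p, ({p : Space d × Ω | Hits r t p.1 (fun i => S i p.2) x}.indicator 1 p +
            a ^ 2 * N p ^ 2) ∂μ := lintegral_mono hpt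
      _ = (∫⁻ y, P {ω | Hits r t y (fun i => S i ω) x}) + a ^ 2 * ∫⁻ p, N p ^ 2 ∂μ := by
          rw [lintegral_add_left (measurable_one.indicator hHm), hH,
            lintegral_const_mul _ (hNm.pow_const 2)]
      _ ≤ (∫⁻ y, P {ω | Hits r t y (fun i => S i ω) x}) + a ^ 2 * (t * ENNReal.ofReal K) := by gcongr
      _ = (∫⁻ y, P {ω | Hits r t y (fun i => S i ω) x}) + a * t := by
          rw [show a ^ 2 * (t * ENNReal.ofReal K) = a * t * (a * ENNReal.ofReal K) by ring, haK,
            mul_one]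
  have hat : a * t = ENNReal.ofReal (t / K) := by
    rw [ha, ← ENNReal.ofReal_natCast, ← ENNReal.ofReal_mul (by positivity)]
    congr 1
    ring
  rw [two_mul, add_mul, hat] at hmain
  exact (ENNReal.add_le_add_iff_right ENNReal.ofReal_ne_top).1 hmain

/-- A sum of a function of the distance to `i` is at most twice the sum of the function. -/
lemma sum_range_le_two_mul {u : ℕ → ℕ → ℝ≥0∞} {q : ℕ → ℝ≥0∞} (h₁ : ∀ i k, u i (i + k) ≤ q k)
    (h₂ : ∀ i k, u (i + k) i ≤ q k) {i t : ℕ} (hi : i < t) :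
    ∑ j ∈ Finset.range t, u i j ≤ 2 * ∑ k ∈ Finset.range t, q k := by
  rw [← Finset.sum_range_add_sum_Ico _ hi.le, two_mul]
  refine add_le_add ?_ ?_
  -- The times before `i` are listed by their lag `i - j ≥ 1`, written so that the sum can be
  -- reflected.
  · calc ∑ j ∈ Finset.range i, u i j ≤ ∑ j ∈ Finset.range i, q (i - 1 - j + 1) := by
          refine Finset.sum_le_sum fun j hj => ?_
          rw [Finset.mem_range] at hj
          have := h₂ j (i - j)
          rwa [Nat.add_sub_cancel' hj.le, show i - j = i - 1 - j + 1 by omega] at this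
      _ = ∑ k ∈ Finset.range i, q (k + 1) := Finset.sum_range_reflect (fun k => q (k + 1)) i
      _ ≤ ∑ k ∈ Finset.range (i + 1), q k := by
          rw [Finset.sum_range_succ']
          exact le_self_add
      _ ≤ _ := Finset.sum_le_sum_of_subset (Finset.range_mono hi)
  · rw [Finset.sum_Ico_eq_sum_range]
    calc _ ≤ ∑ k ∈ Finset.range (t - i), q k := Finset.sum_le_sum fun k _ => h₁ i k
      _ ≤ _ := Finset.sum_le_sum_of_subset (Finset.range_mono (Nat.sub_le t i))

end Estimates

end MobileGraph

namespace MobileGraph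

open Filter Topology

/-! ### Two-sided bounds of order `tailRate` for the swept volume -/

section Bounds

lemma sweptVolume_map {Ω : Type*} [MeasurableSpace Ω] {d : ℕ} {S : ℕ → Ω → Space d}
    {P : Measure Ω} (hS : ∀ i, Measurable (S i)) (r : ℝ) (t : ℕ) (x : ℕ → Space d) :
    sweptVolume (P.map fun ω i => S i ω) r t x = ∫⁻ y, P {ω | Hits r t y (fun i => S i ω) x} :=
  lintegral_congr fun _ => Measure.map_apply (measurable_pi_lambda _ hS)
    (measurableSet_hits r t measurable_const (fun i => measurable_pi_apply i)
      fun _ => measurable_const)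

/-- An upper bound for the probability that a Gaussian walk returns to a ball after `k` steps. -/
noncomputable def returnBound (d : ℕ) (a : ℝ) (k : ℕ) : ℝ := if k = 0 then 1 else (a * (√k)⁻¹) ^ d

lemma returnBound_nonneg (d : ℕ) {a : ℝ} (ha : 0 < a) (k : ℕ) : 0 ≤ returnBound d a k := by
  rw [returnBound]
  split_ifs <;> positivity

/-- The path `x` only shifts the centre of the ball that the increment must enter, and the Gaussian
bound ignores the centre. The factor `4 * r` is the diameter of a ball of radius `2 * r`. -/
lemma IsGaussianWalk.sum_measure_dist_le {Ω : Type*} [MeasurableSpace Ω] {d : ℕ} {v : ℝ≥0}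
    {S : ℕ → Ω → Space d} {P : Measure Ω} (hS : IsGaussianWalk v S P) (hv : v ≠ 0) {r : ℝ}
    (hr : 0 < r) (x : ℕ → Space d) {i t : ℕ} (hi : i < t) :
    ∑ j ∈ Finset.range t, P {ω | dist (S i ω - x i) (S j ω - x j) ≤ 2 * r} ≤
      ENNReal.ofReal (2 * ∑ k ∈ Finset.range t,
        returnBound d (4 * r * (√(2 * Real.pi * v))⁻¹) k) := by
  have := hS.indep.isProbabilityMeasure
  have hvpos : (0 : ℝ) < v := NNReal.coe_pos.2 (pos_iff_ne_zero.2 hv)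
  have ha : 0 < 4 * r * (√(2 * Real.pi * v))⁻¹ := by positivity
  set a := 4 * r * (√(2 * Real.pi * v))⁻¹ with ha_def
  have key : ∀ i k : ℕ, P {ω | dist (S i ω - x i) (S (i + k) ω - x (i + k)) ≤ 2 * r} ≤
      ENNReal.ofReal (returnBound d a k) := by
    intro i k
    rcases eq_or_ne k 0 with rfl | hk
    · simpa [returnBound] using prob_le_one
    have hball : MeasurableSet (Metric.closedBall (x (i + k) - x i) (2 * r)) :=
      Metric.isClosed_closedBall.measurableSet
    have hset : {ω | dist (S i ω - x i) (S (i + k) ω - x (i + k)) ≤ 2 * r} =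
        (fun ω => S (i + k) ω - S i ω) ⁻¹' Metric.closedBall (x (i + k) - x i) (2 * r) := by
      ext ω
      simp only [Set.mem_ofPred_eq, Set.mem_preimage, Metric.mem_closedBall]
      rw [dist_comm, dist_eq_norm, dist_eq_norm]
      congr! 2
      abel
    rw [hset, ← Measure.map_apply_of_aemeasurable (hS.hasLaw_sub i k).aemeasurable hball,
      (hS.hasLaw_sub i k).map_eq]
    refine (isoGaussian_closedBall_le (mul_ne_zero (Nat.cast_ne_zero.2 hk) hv) _ _).trans_eq ?_
    rw [← ENNReal.ofReal_pow (by positivity), returnBound, if_neg hk, ha_def]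
    congr 2
    have : √(2 * Real.pi * ((k * v : ℝ≥0) : ℝ)) = √(2 * Real.pi * v) * √k := by
      rw [← Real.sqrt_mul (by positivity)]
      push_cast
      ring_nf
    rw [this, mul_inv]
    ring
  refine (sum_range_le_two_mul
    (u := fun i j => P {ω | dist (S i ω - x i) (S j ω - x j) ≤ 2 * r}) key
    (fun i k => by simpa only [dist_comm] using key i k) hi).trans_eq ?_
  rw [ENNReal.ofReal_mul zero_le_two, ENNReal.ofReal_sum_of_nonneg fun k _ =>
    returnBound_nonneg d ha k]
  simp

/-- The origin of the threshold `3`: additive constants are absorbed into `log t`. -/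
lemma one_le_log_natCast {t : ℕ} (ht : 3 ≤ t) : 1 ≤ Real.log t := by
  rw [Real.le_log_iff_exp_le (by positivity)]
  have : (3 : ℝ) ≤ t := by exact_mod_cast ht
  linarith [Real.exp_one_lt_three]

lemma tailRate_nonneg (d t : ℕ) : 0 ≤ tailRate d t := by
  rw [tailRate]
  split_ifs
  · exact div_nonneg (by positivity) (Real.log_natCast_nonneg t)
  · positivity

/-- The mean number of returns up to time `t` is of order `log t` in the plane, and bounded in
higher dimensions. -/
lemma exists_tailRate_mul_sum_returnBound_le {d : ℕ} (hd : 2 ≤ d) {a : ℝ} (ha : 0 < a) :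
    ∃ C : ℝ, 0 < C ∧ ∀ t : ℕ, 3 ≤ t →
      tailRate d t * ∑ k ∈ Finset.range t, returnBound d a k ≤ C * t := by
  have hsplit : ∀ t : ℕ, 3 ≤ t → ∑ k ∈ Finset.range t, returnBound d a k =
      ∑ k ∈ Finset.range (t - 1), (a * (√(k + 1 : ℕ))⁻¹) ^ d + 1 := by
    intro t ht
    obtain ⟨n, rfl⟩ : ∃ n, t = n + 1 := ⟨t - 1, by omega⟩
    rw [Finset.sum_range_succ']
    simp [returnBound]
  rcases hd.eq_or_lt with rfl | hd
  -- The lag `0` costs `1 ≤ log t`, and the harmonic sum is at most `1 + log t ≤ 2 * log t`.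
  · refine ⟨1 + 2 * a ^ 2, by positivity, fun t ht => ?_⟩
    have hlog := one_le_log_natCast ht
    have ht0 : (0 : ℝ) < t := by positivity
    have hharm : ∑ k ∈ Finset.range (t - 1), (a * (√(k + 1 : ℕ))⁻¹) ^ 2 =
        a ^ 2 * (harmonic (t - 1) : ℝ) := by
      rw [harmonic, Rat.cast_sum, Finset.mul_sum]
      refine Finset.sum_congr rfl fun k _ => ?_
      rw [mul_pow, inv_pow, Real.sq_sqrt (by positivity)]
      push_cast
      ring
    have hle : (harmonic (t - 1) : ℝ) ≤ 2 * Real.log t := by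
      refine (harmonic_le_one_add_log _).trans ?_
      have : Real.log (t - 1 : ℕ) ≤ Real.log t := by
        refine Real.log_le_log ?_ (by exact_mod_cast Nat.sub_le t 1)
        exact_mod_cast (by omega : 0 < t - 1)
      linarith
    rw [hsplit t ht, hharm, tailRate, if_pos rfl, div_mul_eq_mul_div, div_le_iff₀ (by linarith)]
    have h1 : a ^ 2 * (harmonic (t - 1) : ℝ) + 1 ≤ (1 + 2 * a ^ 2) * Real.log t := by
      nlinarith [mul_le_mul_of_nonneg_left hle (sq_nonneg a)]
    calc _ ≤ (t : ℝ) * ((1 + 2 * a ^ 2) * Real.log t) := by gcongr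
      _ = _ := by ring
  -- For `d ≥ 3` the powers are dominated by the exponent `3`, and the series of `k ^ (-3 / 2)`
  -- converges.
  · have hsum : Summable fun k : ℕ => ((√(k + 1 : ℕ))⁻¹) ^ 3 := by
      have h1 : Summable fun k : ℕ => ((k : ℝ) ^ (3 / 2 : ℝ))⁻¹ :=
        Real.summable_nat_rpow_inv.2 (by norm_num)
      refine ((summable_nat_add_iff 1).2 h1).congr fun k => ?_
      rw [inv_pow, Real.sqrt_eq_rpow, ← Real.rpow_natCast, ← Real.rpow_mul (by positivity)]
      norm_num
    set Z := ∑' k : ℕ, ((√(k + 1 : ℕ))⁻¹) ^ 3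
    have hZ : 0 ≤ Z := tsum_nonneg fun k => by positivity
    refine ⟨a ^ d * Z + 1, by positivity, fun t ht => ?_⟩
    rw [hsplit t ht, tailRate, if_neg hd.ne', mul_comm]
    gcongr
    calc ∑ k ∈ Finset.range (t - 1), (a * (√(k + 1 : ℕ))⁻¹) ^ d
        ≤ ∑ k ∈ Finset.range (t - 1), a ^ d * ((√(k + 1 : ℕ))⁻¹) ^ 3 := by
          refine Finset.sum_le_sum fun k _ => ?_
          rw [mul_pow]
          refine mul_le_mul_of_nonneg_left (pow_le_pow_of_le_one (by positivity) ?_ hd)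
            (by positivity)
          refine inv_le_one_of_one_le₀ (Real.one_le_sqrt.2 ?_)
          exact_mod_cast Nat.le_add_left 1 k
      _ = a ^ d * ∑ k ∈ Finset.range (t - 1), ((√(k + 1 : ℕ))⁻¹) ^ 3 := by rw [Finset.mul_sum]
      _ ≤ a ^ d * Z := by
          gcongr
          exact hsum.sum_le_tsum _ fun k _ => by positivity

/-- The swept volume of a Gaussian walk, relative to any path, is at least of order
`tailRate d t`. -/
lemma exists_le_lintegral_measure_hits {d : ℕ} (hd : 2 ≤ d) {v : ℝ≥0} (hv : v ≠ 0) {r : ℝ}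
    (hr0 : 0 < r) (hr : volume (Metric.closedBall (0 : Space d) r) = 1) :
    ∃ c : ℝ, 0 < c ∧ ∀ t : ℕ, 3 ≤ t → ∀ (Ω : Type*) [MeasurableSpace Ω] (P : Measure Ω)
      (S : ℕ → Ω → Space d), IsGaussianWalk v S P → ∀ x : ℕ → Space d,
      ENNReal.ofReal (c * tailRate d t) ≤ ∫⁻ y, P {ω | Hits r t y (fun i => S i ω) x} := by
  have hvpos : (0 : ℝ) < v := NNReal.coe_pos.2 (pos_iff_ne_zero.2 hv)
  have ha : 0 < 4 * r * (√(2 * Real.pi * v))⁻¹ := by positivity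
  obtain ⟨C, hC, hCt⟩ := exists_tailRate_mul_sum_returnBound_le hd ha
  -- The second moment bound is `t / (2 * R)`, with `R` the sum of the return bounds and `tailRate d
  -- t * R ≤ C * t`.
  refine ⟨(2 * C)⁻¹, by positivity, fun t ht Ω _ P S hS x => ?_⟩
  have := hS.indep.isProbabilityMeasure
  set R := ∑ k ∈ Finset.range t, returnBound d (4 * r * (√(2 * Real.pi * v))⁻¹) k with hR
  have hR0 : 0 < R := by
    refine Finset.sum_pos' (fun k _ => returnBound_nonneg d ha k) ⟨0, ?_, ?_⟩
    · exact Finset.mem_range.2 (by omega)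
    · simp [returnBound]
  refine le_trans (ENNReal.ofReal_le_ofReal ?_) (le_lintegral_measure_hits hS.measurable hr t x
    (by positivity : 0 < 2 * R) fun i hi => hS.sum_measure_dist_le hv hr0 x hi)
  rw [inv_mul_eq_div, div_le_div_iff₀ (by positivity) (by positivity)]
  linarith [hCt t ht]

/-- The exponential factor is smallest at `k = 1`; freezing it there leaves the decay `1 / k`, whose
sum is logarithmic. -/
lemma le_isoGaussian_natCast_mul_closedBall {v : ℝ≥0} (hv : v ≠ 0) {r : ℝ} (hr : 0 < r) {k : ℕ}
    (hk : k ≠ 0) :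
    ENNReal.ofReal (r ^ 2 * (2 * Real.pi * v)⁻¹ * Real.exp (-((r / 2) ^ 2 / v)) * (k : ℝ)⁻¹) ≤
      isoGaussian 2 (k * v) (Metric.closedBall 0 r) := by
  have hvpos : (0 : ℝ) < v := NNReal.coe_pos.2 (pos_iff_ne_zero.2 hv)
  have hk1 : (1 : ℝ) ≤ k := by exact_mod_cast Nat.one_le_iff_ne_zero.2 hk
  refine le_trans ?_
    (le_isoGaussian_closedBall (mul_ne_zero (Nat.cast_ne_zero.2 hk) hv) hr.le)
  rw [← ENNReal.ofReal_pow (by positivity)]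
  refine ENNReal.ofReal_le_ofReal ?_
  push_cast
  rw [mul_pow, mul_pow, inv_pow, Real.sq_sqrt (by positivity), ← Real.exp_nat_mul]
  have h1 : -((r / 2) ^ 2 / (v : ℝ)) ≤ (2 : ℕ) * (-((r / 2) ^ 2) / (2 * (k * v))) := by
    have : (2 : ℕ) * (-((r / 2) ^ 2) / (2 * (k * v))) = -((r / 2) ^ 2 / (k * v)) := by
      push_cast
      field_simp
    rw [this, neg_le_neg_iff]
    exact div_le_div_of_nonneg_left (by positivity) hvpos (le_mul_of_one_le_left hvpos.le hk1)
  calc _ = r ^ 2 * ((2 * Real.pi * (k * v))⁻¹ * Real.exp (-((r / 2) ^ 2 / v))) := by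
        field_simp
    _ ≤ _ := by gcongr

/-- The swept volume of a Gaussian walk is at most of order `tailRate d t`. -/
lemma exists_lintegral_measure_hits_le {d : ℕ} {v : ℝ≥0} (hv : v ≠ 0) {r : ℝ}
    (hr0 : 0 < r) (hr : volume (Metric.closedBall (0 : Space d) r) = 1) :
    ∃ C : ℝ, 0 < C ∧ ∀ t : ℕ, 3 ≤ t → ∀ (Ω : Type*) [MeasurableSpace Ω] (P : Measure Ω)
      (S : ℕ → Ω → Space d), IsGaussianWalk v S P →
      ∫⁻ y, P {ω | Hits r t y (fun i => S i ω) 0} ≤ ENNReal.ofReal (C * tailRate d t) := by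
  have hvpos : (0 : ℝ) < v := NNReal.coe_pos.2 (pos_iff_ne_zero.2 hv)
  rcases eq_or_ne d 2 with rfl | hd
  · have hvol : volume (Metric.closedBall (0 : Space 2) (2 * r)) ≠ ∞ :=
      Metric.isBounded_closedBall.measure_lt_top.ne
    set β := (volume (Metric.closedBall (0 : Space 2) (2 * r))).toReal with hβ
    set b := r ^ 2 * (2 * Real.pi * v)⁻¹ * Real.exp (-((r / 2) ^ 2 / v)) with hb
    have hb0 : 0 < b := by positivity
    have hβ0 : 0 < β := ENNReal.toReal_pos
      (Metric.measure_closedBall_pos _ _ (by positivity)).ne' hvol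
    -- The total occupation `2 * t * β` is divided by the mean time `b * log t` spent after a first
    -- visit.
    refine ⟨2 * β / b, by positivity, fun t ht Ω _ P S hS => ?_⟩
    have hlog := one_le_log_natCast ht
    have hsum : ENNReal.ofReal (b * Real.log t) ≤
        ∑ k ∈ Finset.range t, isoGaussian 2 (k * v) (Metric.closedBall 0 r) := by
      obtain ⟨n, rfl⟩ : ∃ n, t = n + 1 := ⟨t - 1, by omega⟩
      calc ENNReal.ofReal (b * Real.log (n + 1 : ℕ))
          ≤ ENNReal.ofReal (b * (harmonic n : ℝ)) :=
            ENNReal.ofReal_le_ofReal (by gcongr; exact log_add_one_le_harmonic n)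
        _ = ∑ k ∈ Finset.range n, ENNReal.ofReal (b * ((k + 1 : ℕ) : ℝ)⁻¹) := by
            rw [← ENNReal.ofReal_sum_of_nonneg fun k _ => by positivity, harmonic, Rat.cast_sum,
              Finset.mul_sum]
            push_cast
            rfl
        _ ≤ ∑ k ∈ Finset.range n, isoGaussian 2 ((k + 1 : ℕ) * v) (Metric.closedBall 0 r) :=
            Finset.sum_le_sum fun k _ =>
              le_isoGaussian_natCast_mul_closedBall hv hr0 (Nat.succ_ne_zero k)
        _ ≤ _ := by
            rw [Finset.sum_range_succ']
            exact le_self_add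
    have hblog : 0 < b * Real.log t := by positivity
    have hmain := (mul_le_mul_left hsum _).trans (hS.sum_mul_lintegral_hits_le r t)
    rw [mul_comm] at hmain
    refine (ENNReal.le_div_iff_mul_le (Or.inl (ENNReal.ofReal_pos.2 hblog).ne')
      (Or.inl ENNReal.ofReal_ne_top)).2 hmain |>.trans_eq ?_
    rw [← ENNReal.ofReal_toReal hvol, ← hβ, ← ENNReal.ofReal_natCast,
      show (2 : ℝ≥0∞) = ENNReal.ofReal 2 by simp, ← ENNReal.ofReal_mul (by positivity),
      ← ENNReal.ofReal_mul (by positivity), ← ENNReal.ofReal_div_of_pos hblog, tailRate, if_pos rfl]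
    congr 1
    field_simp
  -- The union bound has constant `1` because the ball has volume `1`.
  · refine ⟨1, one_pos, fun t _ Ω _ P S hS => ?_⟩
    have := hS.indep.isProbabilityMeasure
    have := Measure.isProbabilityMeasure_map (μ := P)
      (measurable_pi_lambda (fun ω i => S i ω) hS.measurable).aemeasurable
    rw [← sweptVolume_map hS.measurable, tailRate, if_neg hd, one_mul, ENNReal.ofReal_natCast]
    refine (sweptVolume_le _ r t 0).trans_eq ?_
    rw [hr, mul_one]

lemma radius_pos {d : ℕ} (hd : 2 ≤ d) {r : ℝ}
    (hr : volume (Metric.closedBall (0 : Space d) r) = 1) : 0 < r := by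
  by_contra h
  have : Nonempty (Fin d) := ⟨⟨0, by omega⟩⟩
  have h0 : volume (Metric.closedBall (0 : Space d) r) ≤ volume ({0} : Set (Space d)) := by
    rw [← Metric.closedBall_zero]
    exact measure_mono (Metric.closedBall_subset_closedBall (not_lt.1 h))
  rw [hr, measure_singleton] at h0
  exact absurd h0 (by simp)

end Bounds

/-! ### Tail bounds for the detection time -/

section Target

variable {d : ℕ} {lam : ℝ≥0} {s r : ℝ}

/-- The upper bound for the tail of the detection time. -/
lemma exists_measure_le_detectionTime_le (hd : 2 ≤ d) (hlam : 0 < lam) (hs : 0 < s)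
    (hr : volume (Metric.closedBall (0 : Space d) r) = 1) :
    ∃ c : ℝ, 0 < c ∧ ∀ (Ω : Type*) [MeasurableSpace Ω] (P : Measure Ω) [IsProbabilityMeasure P]
      (V : ℕ → Ω → Space d) (W : ℕ → ℝ≥0 → Ω → Space d) (X : ℝ≥0 → Ω → Space d),
      IsMobileGeometricGraph lam s V W P → (∀ u, Measurable (X u)) →
      IsIndependentOfNodes X V W P → ∀ t : ℕ, 3 ≤ t →
        P.real {ω | (t : ℕ∞) ≤ detectionTime r V W X ω} ≤ Real.exp (-(c * tailRate d t)) := by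
  have hv : NNReal.mk (s ^ 2) (sq_nonneg s) ≠ 0 := fun h =>
    (by positivity : s ^ 2 ≠ 0) (congrArg NNReal.toReal h)
  obtain ⟨c, hc, hct⟩ := exists_le_lintegral_measure_hits hd hv (radius_pos hd hr) hr
  refine ⟨lam * c, mul_pos (NNReal.coe_pos.2 hlam) hc, fun Ω _ P _ V W X h hX hind t ht => ?_⟩
  rw [mul_assoc]
  have hwalk := (h.brownian 0).isGaussianWalk hs
  refine h.measure_le_detectionTime_le hs r hX hind t fun x => ?_
  rw [sweptVolume_map hwalk.measurable]
  exact hct t ht Ω P _ hwalk x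

/-- The lower bound for the tail of the detection time. -/
lemma exists_le_measure_le_detectionTime (hd : 2 ≤ d) (hlam : 0 < lam) (hs : 0 < s)
    (hr : volume (Metric.closedBall (0 : Space d) r) = 1) {v : ℝ≥0} (hv : v ≠ 0) :
    ∃ C : ℝ, 0 < C ∧ ∀ (Ω : Type*) [MeasurableSpace Ω] (P : Measure Ω) [IsProbabilityMeasure P]
      (V : ℕ → Ω → Space d) (W : ℕ → ℝ≥0 → Ω → Space d) (X : ℝ≥0 → Ω → Space d),
      IsMobileGeometricGraph lam s V W P → (∀ u, Measurable (X u)) →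
      IsIndependentOfNodes X V W P →
      IsGaussianWalk v (fun (i : ℕ) ω => W 0 i ω - X i ω) P → ∀ t : ℕ, 3 ≤ t →
        Real.exp (-(C * tailRate d t)) ≤ P.real {ω | (t : ℕ∞) ≤ detectionTime r V W X ω} := by
  obtain ⟨C, hC, hCt⟩ := exists_lintegral_measure_hits_le hv (radius_pos hd hr) hr
  refine ⟨lam * C, mul_pos (NNReal.coe_pos.2 hlam) hC,
    fun Ω _ P _ V W X h hX hind hwalk t ht => ?_⟩
  rw [mul_assoc]
  exact h.le_measure_le_detectionTime hs r hX hind t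
    (mul_nonneg hC.le (tailRate_nonneg d t)) (hCt t ht Ω P _ hwalk)

end Target

end MobileGraph

theorem theorem1 (d : ℕ) (hd : 2 ≤ d) (lam : ℝ≥0) (hlam : 0 < lam) (s : ℝ) (hs : 0 < s)
    (r : ℝ) (hr : volume (Metric.closedBall (0 : MobileGraph.Space d) r) = 1) :
    -- a fixed target, at the origin
    (∃ c C : ℝ, 0 < c ∧ 0 < C ∧ ∃ t₀ : ℕ,
      ∀ (Ω : Type*) [MeasurableSpace Ω] (P : Measure Ω) [IsProbabilityMeasure P]
        (V : ℕ → Ω → MobileGraph.Space d) (W : ℕ → ℝ≥0 → Ω → MobileGraph.Space d),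
        MobileGraph.IsMobileGeometricGraph lam s V W P →
        ∀ t : ℕ, t₀ ≤ t →
          Real.exp (-(C * MobileGraph.tailRate d t)) ≤
            P.real {ω | (t : ℕ∞) ≤ MobileGraph.detectionTime r V W (fun _ _ => 0) ω} ∧
          P.real {ω | (t : ℕ∞) ≤ MobileGraph.detectionTime r V W (fun _ _ => 0) ω} ≤
            Real.exp (-(c * MobileGraph.tailRate d t))) ∧
    -- a target that moves by Brownian motion, from the origin
    (∀ σ : ℝ, 0 < σ → ∃ c C : ℝ, 0 < c ∧ 0 < C ∧ ∃ t₀ : ℕ,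
      ∀ (Ω : Type*) [MeasurableSpace Ω] (P : Measure Ω) [IsProbabilityMeasure P]
        (V : ℕ → Ω → MobileGraph.Space d) (W : ℕ → ℝ≥0 → Ω → MobileGraph.Space d)
        (X : ℝ≥0 → Ω → MobileGraph.Space d),
        MobileGraph.IsMobileGeometricGraph lam s V W P →
        MobileGraph.IsBrownianMotion σ X P →
        MobileGraph.IsIndependentOfNodes X V W P →
        ∀ t : ℕ, t₀ ≤ t →
          Real.exp (-(C * MobileGraph.tailRate d t)) ≤
            P.real {ω | (t : ℕ∞) ≤ MobileGraph.detectionTime r V W X ω} ∧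
          P.real {ω | (t : ℕ∞) ≤ MobileGraph.detectionTime r V W X ω} ≤
            Real.exp (-(c * MobileGraph.tailRate d t))) ∧
    -- the upper bound, for every motion of the target that is independent of the nodes
    (∃ c : ℝ, 0 < c ∧ ∃ t₀ : ℕ,
      ∀ (Ω : Type*) [MeasurableSpace Ω] (P : Measure Ω) [IsProbabilityMeasure P]
        (V : ℕ → Ω → MobileGraph.Space d) (W : ℕ → ℝ≥0 → Ω → MobileGraph.Space d)
        (X : ℝ≥0 → Ω → MobileGraph.Space d),
        MobileGraph.IsMobileGeometricGraph lam s V W P →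
        (∀ u, Measurable (X u)) →
        MobileGraph.IsIndependentOfNodes X V W P →
        ∀ t : ℕ, t₀ ≤ t →
          P.real {ω | (t : ℕ∞) ≤ MobileGraph.detectionTime r V W X ω} ≤
            Real.exp (-(c * MobileGraph.tailRate d t))) := by
  have hv : NNReal.mk (s ^ 2) (sq_nonneg s) ≠ 0 := fun h =>
    (by positivity : s ^ 2 ≠ 0) (congrArg NNReal.toReal h)
  refine ⟨?_, fun σ hσ => ?_, ?_⟩
  · obtain ⟨c, hc, hupper⟩ := MobileGraph.exists_measure_le_detectionTime_le hd hlam hs hr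
    obtain ⟨C, hC, hlower⟩ := MobileGraph.exists_le_measure_le_detectionTime hd hlam hs hr hv
    refine ⟨c, C, hc, hC, 3, fun Ω _ P _ V W h t ht => ?_⟩
    have hind : MobileGraph.IsIndependentOfNodes (fun _ _ => 0) V W P := indepFun_const_left _ _
    refine ⟨hlower Ω P V W _ h (fun _ => measurable_const) hind ?_ t ht,
      hupper Ω P V W _ h (fun _ => measurable_const) hind t ht⟩
    simpa using (h.brownian 0).isGaussianWalk hs
  · obtain ⟨c, hc, hupper⟩ := MobileGraph.exists_measure_le_detectionTime_le hd hlam hs hr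
    obtain ⟨C, hC, hlower⟩ := MobileGraph.exists_le_measure_le_detectionTime hd hlam hs hr
      (v := NNReal.mk (s ^ 2) (sq_nonneg s) + NNReal.mk (σ ^ 2) (sq_nonneg σ))
      (fun h => hv (add_eq_zero.1 h).1)
    refine ⟨c, C, hc, hC, 3, fun Ω _ P _ V W X h hX hind t ht => ?_⟩
    refine ⟨hlower Ω P V W X h hX.measurable hind ?_ t ht,
      hupper Ω P V W X h hX.measurable hind t ht⟩
    -- Seen from the target, a node performs a Gaussian walk with step variance `s ^ 2 + σ ^ 2`.
    refine ((h.brownian 0).isGaussianWalk hs).sub (hX.isGaussianWalk hσ) ?_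
    exact (IndepFun.comp hind (φ := fun (x : ℝ≥0 → MobileGraph.Space d) (i : ℕ) => x i)
      (ψ := fun (p : (ℕ → MobileGraph.Space d) × (ℕ → ℝ≥0 → MobileGraph.Space d)) (i : ℕ) =>
        p.2 0 i) (by fun_prop) (by fun_prop)).symm
  · obtain ⟨c, hc, hupper⟩ := MobileGraph.exists_measure_le_detectionTime_le hd hlam hs hr
    exact ⟨c, hc, 3, fun Ω _ P _ V W X h hX hind t ht => hupper Ω P V W X h hX hind t ht⟩
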